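/- Consider the plant $\dot z=Az+B\psi(Sz)+Nw$, $y=Cz+\eta$, with $z\in\mathbb R^{n_z}$, $y,\eta\in\mathbb R^{n_y}$, $w\in\mathbb R^{n_w}$, where $\psi:\mathbb R^{n_q}\to\mathbb R^{n_s}$ is Lipschitz with constant $\ell>0$. The output is available only at times $t_k$ with $0\le t_1\le T_2$ and $T_1\le t_{k+1}-t_k\le T_2$ for $k\ge1$, where $0<T_1\le T_2$. For gains $L\in\mathbb R^{n_z\times n_y}$, $H\in\mathbb R^{n_y\times n_y}$ consider the observer $\dot{\hat z}=A\hat z+B\psi(S\hat z)+L\theta$, $\dot\theta=H\theta$ for $t\ne t_k$, and $\hat z^+=\hat z$, $\theta^+=y-C\hat z$ at $t=t_k$. With $\varepsilon=z-\hat z$, $\tilde\theta=C(z-\hat z)-\theta$, $\zeta=\psi(Sz)-\psi(S(z-\varepsilon))$ and a timer $\tau$, the interconnection is the hybrid system $\mathcal H_e$ with state $x=(z,\varepsilon,\tilde\theta,\tau)$ and input $u=(w,\eta)$: if $\tau\in[0,T_2]$ it flows by $$\dot z=Az+B\psi(Sz)+Nw,\quad \dot\varepsilon=(A-LC)\varepsilon+L\tilde\theta+B\zeta+Nw,$$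 $$\dot{\tilde\theta}=(CA-CLC-HC)\varepsilon+(CL+H)\tilde\theta+CB\zeta+CNw,\quad \dot\tau=-1,$$ and if $\tau=0$ it jumps by $z^+=z$, $\varepsilon^+=\varepsilon$, $\tilde\theta^+=-\eta$, $\tau^+\in[T_1,T_2]$. Solution pairs $(\phi,u)$ are defined on hybrid time domains, with locally absolutely continuous hybrid arcs $\phi$ and measurable, locally essentially bounded hybrid inputs $u$. Let $y_p=C_p\varepsilon$ be the performance output and $\mathcal A=\mathbb R^{n_z}\times\{0\}\times\{0\}\times[0,T_2]$. Write $\operatorname{He}(M)=M+M^{\mathsf T}$. Let $\lambda_t,\gamma>0$ be given. Suppose that there are symmetric positive definite $P_1\in\mathbb R^{n_z\times n_z}$, $P_2\in\mathbb R^{n_y\times n_y}$, real numbers $\delta,\chi>0$, and matrices $X\in\mathbb R^{n_z\times n_z}$, $U,W\in\mathbb R^{n_y\times n_y}$, $J\in\mathbb R^{n_z\times n_y}$ such that for both $e=1$ and $e=e^{\delta T_2}$ the symmetric matrix $$\begin{pmatrix}\operatorname{He}(Z_1)&Z_2+\mathcal P_e&Z_3&Z_4\\ \bullet&\mathcal N_e+\operatorname{He}(Z_5)&Z_3&Z_4\\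 \bullet&\bullet&-\gamma^2I&0\\ \bullet&\bullet&\bullet&-\chi I\end{pmatrix}$$ is negative definite, where $\mathcal P_e=\operatorname{diag}\{P_1,eP_2\}$, $\mathcal N_e=\operatorname{diag}\{2\lambda_tP_1+C_p^{\mathsf T}C_p+\chi\ell^2S^{\mathsf T}S,\ (-\delta+2\lambda_t)eP_2\}$, $$Z_1=\begin{pmatrix}-X&C^{\mathsf T}U\\0&-U\end{pmatrix},\quad Z_2=\begin{pmatrix}-X+X^{\mathsf T}A-JC&J\\-WC&W\end{pmatrix},$$ $$Z_3=\begin{pmatrix}X^{\mathsf T}N\\0\end{pmatrix},\quad Z_4=\begin{pmatrix}X^{\mathsf T}B\\0\end{pmatrix},\quad Z_5=\begin{pmatrix}A^{\mathsf T}X-C^{\mathsf T}J^{\mathsf T}&0\\J^{\mathsf T}&0\end{pmatrix}.$$ Then $X$ and $U$ are invertible, and with the gains $L=X^{-\mathsf T}J$ and $H=U^{-\mathsf T}W$ the following hold. (P1) $\mathcal A$ is globally exponentially stable for $\mathcal H_e$ with zero input, with convergence rate $\lambda_t$ in ordinary time: there are $\kappa,\lambda>0$ such that every solution $\phi$ with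 $w\equiv0$, $\eta\equiv0$ satisfies $|\phi(t,j)|_{\mathcal A}\le\kappa e^{-\lambda_tt}|\phi(0,0)|_{\mathcal A}$ and $|\phi(t,j)|_{\mathcal A}\le\kappa e^{-\lambda(t+j)}|\phi(0,0)|_{\mathcal A}$ for all $(t,j)\in\operatorname{dom}\phi$, and every maximal such solution is complete. (P2) $\mathcal H_e$ is exponentially input-to-state stable with respect to $\mathcal A$, so that the estimation error is bounded for bounded disturbances: there are $\kappa,\lambda>0$ and $\rho\in\mathcal K$ such that every solution pair $(\phi,u)$ with $\|u\|_\infty<\infty$ satisfies $|\phi(t,j)|_{\mathcal A}\le\max\{\kappa e^{-\lambda(t+j)}|\phi(0,0)|_{\mathcal A},\rho(\|u\|_\infty)\}$ for all $(t,j)\in\operatorname{dom}\phi$, and every maximal solution pair with $\|u\|_\infty<\infty$ is complete. (P3) The $\mathcal L_2$-gain from $w$ to $y_p$ is at most $\gamma$ when $\eta\equiv0$: there is $\alpha>0$ such that every solution pair with $\eta\equiv0$ satisfies $$\sqrt{\int_{\mathcal I}|y_p(s,j(s))|^2ds}\le\alpha|\phi(0,0)|_{\mathcal A}+\gamma\sqrt{\int_{\mathcal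 I}|w(s,j(s))|^2ds},$$ where $\mathcal I=\operatorname{dom}_t\phi$ is the set of ordinary times of $\operatorname{dom}\phi$ and $j(s)=\min\{j:(s,j)\in\operatorname{dom}\phi\}$. -/

import Mathlib

open Set MeasureTheory Matrix
open scoped ENNReal

noncomputable section

/-! ## Hybrid systems, hybrid time domains, solution pairs -/

/-- A hybrid system with state in `X` and input `u = (w, η) ∈ W × Y`:
`ẋ = flow x w` on `flowSet`, and `x⁺ ∈ jump x η` on `jumpSet`. -/
structure HybridSystem (X W Y : Type*) where
  flow : X → W → X
  flowSet : Set X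
  jump : X → Y → Set X
  jumpSet : Set X

/-- `{t | (t, j) ∈ E}`: the interval of times at which the jump counter equals `j`. -/
def timeSlice (E : Set (ℝ × ℕ)) (j : ℕ) : Set ℝ := {t | (t, j) ∈ E}

/-- Hybrid time domains: the union of an infinite sequence of intervals `[t j, t (j+1)] × {j}`, or
of a finite one, whose last interval may be `[t J, t (J+1)]`, `[t J, t (J+1))` or `[t J, ∞)`. -/
def IsHybridTimeDomain (E : Set (ℝ × ℕ)) : Prop :=
  ∃ t : ℕ → ℝ, t 0 = 0 ∧ Monotone t ∧
    ((∀ j, timeSlice E j = Icc (t j) (t (j + 1))) ∨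
      ∃ J : ℕ, (∀ j < J, timeSlice E j = Icc (t j) (t (j + 1))) ∧
        (timeSlice E J = Icc (t J) (t (J + 1)) ∨
          (t J < t (J + 1) ∧ timeSlice E J = Ico (t J) (t (J + 1))) ∨
          timeSlice E J = Ici (t J)) ∧
        ∀ j, J < j → timeSlice E j = ∅)

/-- The points `(t, j)` of the domain at which a jump occurs, i.e. `(t, j + 1)` is in the domain. -/
def jumpPoints (E : Set (ℝ × ℕ)) : Set (ℝ × ℕ) := {p | p ∈ E ∧ (p.1, p.2 + 1) ∈ E}

/-- `u` is a hybrid input on `E`: for each `j`, `u(·, j)` is (Lebesgue) measurable and locally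
essentially bounded. -/
def IsHybridInput {V : Type*} [NormedAddCommGroup V] (E : Set (ℝ × ℕ)) (u : ℝ → ℕ → V) : Prop :=
  ∀ j, AEStronglyMeasurable (fun t => u t j) (volume.restrict (timeSlice E j)) ∧
    ∀ K : Set ℝ, IsCompact K → K ⊆ timeSlice E j →
      ∃ M : ℝ, ∀ᵐ t ∂(volume.restrict K), ‖u t j‖ ≤ M

/-- `φ` is a hybrid arc on `E`: for each `j`, `φ(·, j)` is locally absolutely continuous. -/
def IsHybridArc {V : Type*} [NormedAddCommGroup V] (E : Set (ℝ × ℕ)) (φ : ℝ → ℕ → V) : Prop :=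
  ∀ j, ∀ a ∈ timeSlice E j, ∀ b ∈ timeSlice E j,
    AbsolutelyContinuousOnInterval (fun t => φ t j) a b

/-- `(φ, (w, η))` is a solution pair, with common domain `E`, to the hybrid system `Sys`. Signals
are represented by functions on `ℝ × ℕ`, of which only the values on `E` matter. -/
structure IsSolutionPair {X W Y : Type*} [NormedAddCommGroup X] [NormedSpace ℝ X]
    [NormedAddCommGroup W] [NormedAddCommGroup Y] (Sys : HybridSystem X W Y)
    (E : Set (ℝ × ℕ)) (φ : ℝ → ℕ → X) (w : ℝ → ℕ → W) (η : ℝ → ℕ → Y) : Prop where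
  timeDomain : IsHybridTimeDomain E
  arc : IsHybridArc E φ
  input_w : IsHybridInput E w
  input_η : IsHybridInput E η
  initial : φ 0 0 ∈ Sys.flowSet ∪ Sys.jumpSet
  flows : ∀ j, ∀ᵐ t ∂(volume.restrict (timeSlice E j)),
    φ t j ∈ Sys.flowSet ∧ HasDerivAt (fun s => φ s j) (Sys.flow (φ t j) (w t j)) t
  jumps : ∀ t j, (t, j) ∈ jumpPoints E →
    φ t j ∈ Sys.jumpSet ∧ φ t (j + 1) ∈ Sys.jump (φ t j) (η t j)

/-- The signal `u` vanishes identically on `E`. -/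
def ZeroOn {V : Type*} [Zero V] (E : Set (ℝ × ℕ)) (u : ℝ → ℕ → V) : Prop :=
  ∀ t j, (t, j) ∈ E → u t j = 0

/-- A domain is complete when it is unbounded. -/
def IsCompleteDomain (E : Set (ℝ × ℕ)) : Prop := ∀ M : ℝ, ∃ p ∈ E, M < p.1 + p.2

/-- A solution pair is maximal if it has no extension to a solution pair with larger domain. -/
def IsMaximalPair {X W Y : Type*} [NormedAddCommGroup X] [NormedSpace ℝ X]
    [NormedAddCommGroup W] [NormedAddCommGroup Y] (Sys : HybridSystem X W Y)
    (E : Set (ℝ × ℕ)) (φ : ℝ → ℕ → X) (w : ℝ → ℕ → W) (η : ℝ → ℕ → Y) : Prop :=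
  IsSolutionPair Sys E φ w η ∧
    ∀ E' φ' w' η', IsSolutionPair Sys E' φ' w' η' → E ⊆ E' →
      (∀ t j, (t, j) ∈ E → φ' t j = φ t j ∧ w' t j = w t j ∧ η' t j = η t j) → E' = E

/-- A solution with zero input is maximal (as such) if it has no extension to a solution with zero
input and larger domain. -/
def IsMaximalZeroInput {X W Y : Type*} [NormedAddCommGroup X] [NormedSpace ℝ X]
    [NormedAddCommGroup W] [NormedAddCommGroup Y] (Sys : HybridSystem X W Y)
    (E : Set (ℝ × ℕ)) (φ : ℝ → ℕ → X) : Prop :=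
  IsSolutionPair Sys E φ 0 0 ∧
    ∀ E' φ', IsSolutionPair Sys E' φ' 0 0 → E ⊆ E' →
      (∀ t j, (t, j) ∈ E → φ' t j = φ t j) → E' = E

/-- The `L∞` norm of a hybrid signal: the essential supremum along flows, and the supremum over the
points where jumps occur. -/
def linfNorm {V : Type*} [NormedAddCommGroup V] (E : Set (ℝ × ℕ)) (u : ℝ → ℕ → V) : ℝ≥0∞ :=
  max (⨆ j : ℕ, essSup (fun t => ‖u t j‖ₑ) (volume.restrict (timeSlice (E \ jumpPoints E) j)))
    (⨆ p ∈ jumpPoints E, ‖u p.1 p.2‖ₑ)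

/-- The input signal `u = (w, η)`, with the Euclidean norm `|u|² = |w|² + |η|²`. -/
def pairInput {W Y : Type*} (w : ℝ → ℕ → W) (η : ℝ → ℕ → Y) : ℝ → ℕ → WithLp 2 (W × Y) :=
  fun t j => WithLp.toLp 2 (w t j, η t j)

/-- Class `K` functions `[0, ∞) → [0, ∞)`. -/
def IsClassK (ρ : ℝ → ℝ) : Prop :=
  ContinuousOn ρ (Ici 0) ∧ StrictMonoOn ρ (Ici 0) ∧ ρ 0 = 0

/-- Exponential input-to-state stability with respect to `𝒜`: the estimate holds along every
solution pair with input in `L∞`, and the maximal ones among these are complete. -/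
def IsEISS {X W Y : Type*} [NormedAddCommGroup X] [NormedSpace ℝ X]
    [NormedAddCommGroup W] [NormedAddCommGroup Y] (Sys : HybridSystem X W Y) (𝒜 : Set X) : Prop :=
  (∃ κ > 0, ∃ rate > 0, ∃ ρ : ℝ → ℝ, IsClassK ρ ∧
    ∀ E φ w η, IsSolutionPair Sys E φ w η → linfNorm E (pairInput w η) < ∞ →
      ∀ t j, (t, j) ∈ E →
        Metric.infDist (φ t j) 𝒜 ≤
          max (κ * Real.exp (-rate * (t + j)) * Metric.infDist (φ 0 0) 𝒜)
            (ρ (linfNorm E (pairInput w η)).toReal)) ∧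
  ∀ E φ w η, IsMaximalPair Sys E φ w η → linfNorm E (pairInput w η) < ∞ → IsCompleteDomain E

/-- Global exponential stability of `𝒜` under zero input, with convergence rate `lam` with respect
to ordinary time; maximal solutions are complete. -/
def IsGESWithRate {X W Y : Type*} [NormedAddCommGroup X] [NormedSpace ℝ X]
    [NormedAddCommGroup W] [NormedAddCommGroup Y] (Sys : HybridSystem X W Y) (𝒜 : Set X)
    (lam : ℝ) : Prop :=
  (∃ κ > 0, ∃ rate > 0, ∀ E φ w η, IsSolutionPair Sys E φ w η → ZeroOn E w → ZeroOn E η →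
    ∀ t j, (t, j) ∈ E →
      Metric.infDist (φ t j) 𝒜 ≤ κ * Real.exp (-lam * t) * Metric.infDist (φ 0 0) 𝒜 ∧
      Metric.infDist (φ t j) 𝒜 ≤ κ * Real.exp (-rate * (t + j)) * Metric.infDist (φ 0 0) 𝒜) ∧
  ∀ E φ, IsMaximalZeroInput Sys E φ → IsCompleteDomain E

/-- `dom_t`: the ordinary times occurring in the hybrid time domain. -/
def ordinaryTimes (E : Set (ℝ × ℕ)) : Set ℝ := {t | ∃ j, (t, j) ∈ E}

/-- The smallest jump counter at ordinary time `t`. -/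
def firstCounter (E : Set (ℝ × ℕ)) (t : ℝ) : ℕ := sInf {j | (t, j) ∈ E}

/-- The `L²` norm over ordinary time of a hybrid signal, in `[0, ∞]`. -/
def l2Norm {V : Type*} [NormedAddCommGroup V] (E : Set (ℝ × ℕ)) (u : ℝ → ℕ → V) : ℝ≥0∞ :=
  eLpNorm (fun s => u s (firstCounter E s)) 2 (volume.restrict (ordinaryTimes E))

/-- `L²`-external stability, with gain `γ`, from `w` to the output `h(x)` when `η ≡ 0`. -/
def HasL2Gain {X W Y V : Type*} [NormedAddCommGroup X] [NormedSpace ℝ X]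
    [NormedAddCommGroup W] [NormedAddCommGroup Y] [NormedAddCommGroup V]
    (Sys : HybridSystem X W Y) (𝒜 : Set X) (h : X → V) (γ : ℝ) : Prop :=
  ∃ α > 0, ∀ E φ w η, IsSolutionPair Sys E φ w η → ZeroOn E η →
    l2Norm E (fun t j => h (φ t j)) ≤
      ENNReal.ofReal (α * Metric.infDist (φ 0 0) 𝒜) + ENNReal.ofReal γ * l2Norm E w

/-! ## The plant, the observer, and the hybrid model of their interconnection -/

/-- Euclidean space `ℝⁿ`. -/
abbrev Vec (n : ℕ) := EuclideanSpace ℝ (Fin n)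

/-- The plant `ż = A z + B ψ(S z) + N w`, `y = C z + η`, with performance output
`y_p = Cp (z - ẑ)`. -/
structure Plant (nz ny nw nq ns np : ℕ) where
  A : Matrix (Fin nz) (Fin nz) ℝ
  B : Matrix (Fin nz) (Fin ns) ℝ
  C : Matrix (Fin ny) (Fin nz) ℝ
  N : Matrix (Fin nz) (Fin nw) ℝ
  S : Matrix (Fin nq) (Fin nz) ℝ
  Cp : Matrix (Fin np) (Fin nz) ℝ
  ψ : Vec nq → Vec ns

/-- The state space `ℝ^(nz + (nz + ny) + 1)`, whose elements are `x = (z, (ε, θ̃), τ)`. -/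
abbrev HState (nz ny : ℕ) := EuclideanSpace ℝ (Fin nz ⊕ ((Fin nz ⊕ Fin ny) ⊕ Unit))

namespace HState

variable {nz ny : ℕ}

/-- The vector `(z, e, τ)`, where `e = (ε, θ̃)`. -/
def mk (z : Fin nz → ℝ) (e : Fin nz ⊕ Fin ny → ℝ) (τ : ℝ) : HState nz ny :=
  WithLp.toLp 2 (Sum.elim z (Sum.elim e fun _ => τ))

/-- The plant state `z`. -/
def z (x : HState nz ny) : Fin nz → ℝ := fun i => x (Sum.inl i)

/-- The pair `(ε, θ̃)`. -/
def err (x : HState nz ny) : Fin nz ⊕ Fin ny → ℝ := fun i => x (Sum.inr (Sum.inl i))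

/-- The estimation error `ε = z - ẑ`. -/
def ε (x : HState nz ny) : Fin nz → ℝ := fun i => x.err (Sum.inl i)

/-- The timer `τ`. -/
def τ (x : HState nz ny) : ℝ := x (Sum.inr (Sum.inr ()))

end HState

namespace Plant

variable {nz ny nw nq ns np : ℕ}

/-- `ψ(S v)`. -/
def nonlin (P : Plant nz ny nw nq ns np) (v : Fin nz → ℝ) : Fin ns → ℝ :=
  (P.ψ (WithLp.toLp 2 (P.S *ᵥ v))).ofLp

/-- `ζ(v₁, v₂) = ψ(S v₁) - ψ(S (v₁ - v₂))`. -/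
def zeta (P : Plant nz ny nw nq ns np) (v₁ v₂ : Fin nz → ℝ) : Fin ns → ℝ :=
  P.nonlin v₁ - P.nonlin (v₁ - v₂)

/-- The right-hand side `A z + B ψ(S z) + N w` of the plant. -/
def plantField (P : Plant nz ny nw nq ns np) (z : Fin nz → ℝ) (w : Fin nw → ℝ) : Fin nz → ℝ :=
  P.A *ᵥ z + P.B *ᵥ P.nonlin z + P.N *ᵥ w

/-- The matrix `𝓕` of the error dynamics for the observer gains `L`, `H`. -/
def calF (P : Plant nz ny nw nq ns np) (L : Matrix (Fin nz) (Fin ny) ℝ)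
    (H : Matrix (Fin ny) (Fin ny) ℝ) : Matrix (Fin nz ⊕ Fin ny) (Fin nz ⊕ Fin ny) ℝ :=
  fromBlocks (P.A - L * P.C) L (P.C * P.A - P.C * L * P.C - H * P.C) (P.C * L + H)

/-- The matrix `𝓠 = (B; C B)`. -/
def calQ (P : Plant nz ny nw nq ns np) : Matrix (Fin nz ⊕ Fin ny) (Fin ns) ℝ :=
  fromRows P.B (P.C * P.B)

/-- The matrix `𝓣 = (N; C N)`. -/
def calT (P : Plant nz ny nw nq ns np) : Matrix (Fin nz ⊕ Fin ny) (Fin nw) ℝ :=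
  fromRows P.N (P.C * P.N)

/-- The matrix `𝓖 = diag(I, 0)`. -/
def calG (nz ny : ℕ) : Matrix (Fin nz ⊕ Fin ny) (Fin nz ⊕ Fin ny) ℝ :=
  fromBlocks 1 0 0 0

/-- The matrix `𝓝 = (0; -I)`. -/
def calN (nz ny : ℕ) : Matrix (Fin nz ⊕ Fin ny) (Fin ny) ℝ :=
  fromRows 0 (-1)

/-- The hybrid model of the plant interconnected with the observer with gains `L`, `H`
(`ẑ' = A ẑ + B ψ(S ẑ) + L θ`, `θ' = H θ` between samples; `θ⁺ = y - C ẑ` at samples), with sampling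
intervals in `[T₁, T₂]`, in the coordinates `z`, `ε = z - ẑ`, `θ̃ = C (z - ẑ) - θ`, `τ`. -/
def errorSystem (P : Plant nz ny nw nq ns np) (L : Matrix (Fin nz) (Fin ny) ℝ)
    (H : Matrix (Fin ny) (Fin ny) ℝ) (T₁ T₂ : ℝ) :
    HybridSystem (HState nz ny) (Vec nw) (Vec ny) where
  flow x w := HState.mk (P.plantField x.z w.ofLp)
    (P.calF L H *ᵥ x.err + P.calQ *ᵥ P.zeta x.z x.ε + P.calT *ᵥ w.ofLp) (-1)
  flowSet := {x | x.τ ∈ Icc 0 T₂}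
  jump x η := {g | ∃ v ∈ Icc T₁ T₂,
    g = HState.mk x.z (calG nz ny *ᵥ x.err + calN nz ny *ᵥ η.ofLp) v}
  jumpSet := {x | x.τ = 0}

/-- The set `ℝ^nz × {0} × {0} × [0, T₂]`. -/
def attractor (nz ny : ℕ) (T₂ : ℝ) : Set (HState nz ny) := {x | x.err = 0 ∧ x.τ ∈ Icc 0 T₂}

/-- The performance output `y_p = Cp ε`. -/
def perfOutput (P : Plant nz ny nw nq ns np) (x : HState nz ny) : Vec np :=
  WithLp.toLp 2 (P.Cp *ᵥ x.ε)

/-- The observer with gains `L`, `H` solves the estimation problem: exponential stability with rate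
`lam` without disturbances, bounded error (in the input-to-state sense) under bounded disturbances,
and `L²`-gain at most `γ` from `w` to `y_p` without measurement noise. -/
def ObserverSolves (P : Plant nz ny nw nq ns np) (T₁ T₂ lam γ : ℝ)
    (L : Matrix (Fin nz) (Fin ny) ℝ) (H : Matrix (Fin ny) (Fin ny) ℝ) : Prop :=
  IsGESWithRate (P.errorSystem L H T₁ T₂) (attractor nz ny T₂) lam ∧
  IsEISS (P.errorSystem L H T₁ T₂) (attractor nz ny T₂) ∧
  HasL2Gain (P.errorSystem L H T₁ T₂) (attractor nz ny T₂) P.perfOutput γ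

/-! ### The error coordinates -/

/-- The right-hand side `A ẑ + B ψ(S ẑ) + L θ` of the observer. -/
def observerField (P : Plant nz ny nw nq ns np) (L : Matrix (Fin nz) (Fin ny) ℝ)
    (zh : Fin nz → ℝ) (θ : Fin ny → ℝ) : Fin nz → ℝ :=
  P.A *ᵥ zh + P.B *ᵥ P.nonlin zh + L *ᵥ θ

/-- The linear change of coordinates `(z, ẑ, θ, τ) ↦ (z, z - ẑ, C (z - ẑ) - θ, τ)`. -/
def toError (P : Plant nz ny nw nq ns np) (z zh : Fin nz → ℝ) (θ : Fin ny → ℝ) (τ : ℝ) :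
    HState nz ny :=
  HState.mk z (Sum.elim (z - zh) (P.C *ᵥ (z - zh) - θ)) τ

/-- In error coordinates, the flow of plant, observer and timer is the flow map above. -/
theorem errorSystem_flow_toError (P : Plant nz ny nw nq ns np) (L : Matrix (Fin nz) (Fin ny) ℝ)
    (H : Matrix (Fin ny) (Fin ny) ℝ) (T₁ T₂ : ℝ) (z zh : Fin nz → ℝ) (θ : Fin ny → ℝ) (τ : ℝ)
    (w : Vec nw) :
    (P.errorSystem L H T₁ T₂).flow (P.toError z zh θ τ) w =
      P.toError (P.plantField z w.ofLp) (P.observerField L zh θ) (H *ᵥ θ) (-1) := by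
  have h1 : (P.toError z zh θ τ).z = z := rfl
  have h2 : (P.toError z zh θ τ).err = Sum.elim (z - zh) (P.C *ᵥ (z - zh) - θ) := rfl
  have h3 : (P.toError z zh θ τ).ε = z - zh := rfl
  simp only [errorSystem, h1, h2, h3]
  unfold toError
  congr 1
  simp only [calF, calQ, calT, zeta, plantField, observerField, fromBlocks_mulVec,
    fromRows_mulVec, sub_sub_cancel, Sum.elim_comp_inl, Sum.elim_comp_inr]
  ext i
  rcases i with i | i <;>
    simp [Matrix.sub_mulVec, Matrix.add_mulVec, Matrix.mulVec_sub, Matrix.mulVec_add,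
      ← Matrix.mulVec_mulVec] <;> ring

/-- In error coordinates, resetting `θ` to `y - C ẑ`, with `y = C z + η`, is the jump map above. -/
theorem errorSystem_jump_toError (P : Plant nz ny nw nq ns np) (L : Matrix (Fin nz) (Fin ny) ℝ)
    (H : Matrix (Fin ny) (Fin ny) ℝ) (T₁ T₂ : ℝ) (z zh : Fin nz → ℝ) (θ : Fin ny → ℝ) (τ : ℝ)
    (η : Vec ny) :
    (P.errorSystem L H T₁ T₂).jump (P.toError z zh θ τ) η =
      {g | ∃ v ∈ Icc T₁ T₂, g = P.toError z zh ((P.C *ᵥ z + η.ofLp) - P.C *ᵥ zh) v} := by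
  have h1 : (P.toError z zh θ τ).z = z := rfl
  have h2 : (P.toError z zh θ τ).err = Sum.elim (z - zh) (P.C *ᵥ (z - zh) - θ) := rfl
  have h3 : calG nz ny *ᵥ Sum.elim (z - zh) (P.C *ᵥ (z - zh) - θ) + calN nz ny *ᵥ η.ofLp =
      Sum.elim (z - zh) (P.C *ᵥ (z - zh) - (P.C *ᵥ z + η.ofLp - P.C *ᵥ zh)) := by
    ext i
    rcases i with i | i <;>
      simp [calG, calN, fromBlocks_mulVec, fromRows_mulVec, Matrix.mulVec_sub, Matrix.neg_mulVec]
  simp only [errorSystem, h1, h2, h3]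
  rfl

/-! ## The linear matrix inequalities -/

/-- `He(M) = M + Mᵀ`. -/
def he {n : Type*} (M : Matrix n n ℝ) : Matrix n n ℝ := M + Mᵀ

/-- The symmetric block matrix of the design inequalities, with `e = 1` in the first of them and
`e = exp(δ T₂)` in the second. -/
def designMatrix (P : Plant nz ny nw nq ns np) (ℓ lam γ δ χ e : ℝ)
    (P₁ X : Matrix (Fin nz) (Fin nz) ℝ) (P₂ U W : Matrix (Fin ny) (Fin ny) ℝ)
    (J : Matrix (Fin nz) (Fin ny) ℝ) :
    Matrix (((Fin nz ⊕ Fin ny) ⊕ (Fin nz ⊕ Fin ny)) ⊕ (Fin nw ⊕ Fin ns))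
      (((Fin nz ⊕ Fin ny) ⊕ (Fin nz ⊕ Fin ny)) ⊕ (Fin nw ⊕ Fin ns)) ℝ :=
  let calP : Matrix (Fin nz ⊕ Fin ny) (Fin nz ⊕ Fin ny) ℝ := fromBlocks P₁ 0 0 (e • P₂)
  let calM : Matrix (Fin nz ⊕ Fin ny) (Fin nz ⊕ Fin ny) ℝ :=
    fromBlocks ((2 * lam) • P₁ + P.Cpᵀ * P.Cp + (χ * ℓ ^ 2) • (P.Sᵀ * P.S)) 0
      0 (((-δ + 2 * lam) * e) • P₂)
  let Z₁ : Matrix (Fin nz ⊕ Fin ny) (Fin nz ⊕ Fin ny) ℝ := fromBlocks (-X) (P.Cᵀ * U) 0 (-U)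
  let Z₂ : Matrix (Fin nz ⊕ Fin ny) (Fin nz ⊕ Fin ny) ℝ :=
    fromBlocks (-X + Xᵀ * P.A - J * P.C) J (-(W * P.C)) W
  let Z₃ : Matrix (Fin nz ⊕ Fin ny) (Fin nw) ℝ := fromRows (Xᵀ * P.N) 0
  let Z₄ : Matrix (Fin nz ⊕ Fin ny) (Fin ns) ℝ := fromRows (Xᵀ * P.B) 0
  let Z₅ : Matrix (Fin nz ⊕ Fin ny) (Fin nz ⊕ Fin ny) ℝ :=
    fromBlocks (P.Aᵀ * X - P.Cᵀ * Jᵀ) 0 Jᵀ 0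
  let Z₆ : Matrix (Fin nz ⊕ Fin ny) (Fin nw) ℝ := fromRows (Xᵀ * P.N) 0
  let Z₇ : Matrix (Fin nz ⊕ Fin ny) (Fin ns) ℝ := fromRows (Xᵀ * P.B) 0
  let upper := fromBlocks Z₃ Z₄ Z₆ Z₇
  fromBlocks (fromBlocks (he Z₁) (Z₂ + calP) (Z₂ + calP)ᵀ (calM + he Z₅)) upper
    upperᵀ (fromBlocks (-(γ ^ 2) • 1) 0 0 (-χ • 1))

/-- The design inequalities: both block matrices are negative definite. -/
def DesignLMI (P : Plant nz ny nw nq ns np) (ℓ T₂ lam γ δ χ : ℝ)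
    (P₁ X : Matrix (Fin nz) (Fin nz) ℝ) (P₂ U W : Matrix (Fin ny) (Fin ny) ℝ)
    (J : Matrix (Fin nz) (Fin ny) ℝ) : Prop :=
  (-(P.designMatrix ℓ lam γ δ χ 1 P₁ X P₂ U W J)).PosDef ∧
  (-(P.designMatrix ℓ lam γ δ χ (Real.exp (δ * T₂)) P₁ X P₂ U W J)).PosDef

end Plant

end

/-!
The proof is a Lyapunov argument with `V = εᵀ P₁ ε + exp (δ τ) θ̃ᵀ P₂ θ̃`, which is comparable to
the squared distance to the attractor. Evaluating the design inequality at
`(ε̇, dθ̃/dt, ε, θ̃, w, ζ)`, the terms carrying the multipliers `X` and `U` vanish along the error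
dynamics, and what remains is `V̇ ≤ -2 λ_t V - |y_p|² + γ² |w|²`. The matrix is affine in
`e = exp (δ τ)`, so the two endpoints `e = 1` and `e = exp (δ T₂)` cover all values of the timer.

A jump erases the `θ̃` part of `V` and adds at most a multiple of `|η|²`. Consecutive jumps are at
least `T₁` apart, so the decay between jumps turns the accumulated jump terms into a geometric
series; integrating the dissipation inequality instead gives the `L₂` bound. A maximal solution is
complete because the flow is Lipschitz, which rules out escape in finite time, and at every point
of the flow set the timer allows either a flow or a jump.
-/

/-! ## Absolutely continuous functions -/

section AbsolutelyContinuous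

variable {X Y : Type*} {a b c : ℝ}

theorem absolutelyContinuousOnInterval_of_dist_le [PseudoMetricSpace X] [PseudoMetricSpace Y]
    {f : ℝ → X} {g : ℝ → Y} (K : ℝ)
    (hgf : ∀ s ∈ uIcc a b, ∀ t ∈ uIcc a b, dist (g s) (g t) ≤ K * dist (f s) (f t))
    (hf : AbsolutelyContinuousOnInterval f a b) : AbsolutelyContinuousOnInterval g a b := by
  refine squeeze_zero' (.of_forall fun _ => Finset.sum_nonneg fun _ _ => dist_nonneg) ?_
    (by simpa only [mul_zero] using Filter.Tendsto.const_mul K hf)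
  rw [Filter.eventually_inf_principal]
  filter_upwards with I hI
  rw [Finset.mul_sum]
  exact Finset.sum_le_sum fun i hi => hgf _ (hI.1 i hi).1 _ (hI.1 i hi).2

theorem absolutelyContinuousOnInterval_congr [PseudoMetricSpace X] {f g : ℝ → X}
    (h : EqOn f g (uIcc a b)) (hf : AbsolutelyContinuousOnInterval f a b) :
    AbsolutelyContinuousOnInterval g a b :=
  absolutelyContinuousOnInterval_of_dist_le 1
    (fun s hs t ht => by rw [h hs, h ht, one_mul]) hf

theorem absolutelyContinuousOnInterval_const [PseudoMetricSpace X] (x : X) :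
    AbsolutelyContinuousOnInterval (fun _ => x) a b :=
  (LipschitzWith.const x).lipschitzOnWith.absolutelyContinuousOnInterval

theorem absolutelyContinuousOnInterval_comp_of_locallyLipschitz [SeminormedAddCommGroup X]
    [PseudoMetricSpace Y] {f : ℝ → X} {g : X → Y} (hg : LocallyLipschitz g)
    (hf : AbsolutelyContinuousOnInterval f a b) :
    AbsolutelyContinuousOnInterval (fun t => g (f t)) a b := by
  obtain ⟨K, hK⟩ := LocallyLipschitzOn.exists_lipschitzOnWith_of_compact
    (isCompact_uIcc.image_of_continuousOn hf.continuousOn)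
    (hg.locallyLipschitzOn (s := f '' uIcc a b))
  exact absolutelyContinuousOnInterval_of_dist_le K (fun s hs t ht =>
    hK.dist_le_mul _ (mem_image_of_mem f hs) _ (mem_image_of_mem f ht)) hf

theorem absolutelyContinuousOnInterval_comp_projIcc [PseudoMetricSpace X] {f : ℝ → X}
    (hab : a ≤ b) (hf : AbsolutelyContinuousOnInterval f a b) (c d : ℝ) :
    AbsolutelyContinuousOnInterval (fun t => f (projIcc a b hab t)) c d := by
  rw [absolutelyContinuousOnInterval_iff] at hf ⊢
  intro ε hε
  obtain ⟨r, hr, h⟩ := hf ε hε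
  refine ⟨r, hr, fun I hI hlt =>
    h (I.1, fun i => (projIcc a b hab (I.2 i).1, projIcc a b hab (I.2 i).2)) ⟨fun i _ => ?_, ?_⟩ ?_⟩
  · rw [uIcc_of_le hab]
    exact ⟨Subtype.prop _, Subtype.prop _⟩
  · refine hI.2.mono fun i s hs => ?_
    simp only [coe_projIcc, uIoc, mem_Ioc] at hs ⊢
    grind
  · refine (Finset.sum_le_sum fun i _ => ?_).trans_lt hlt
    simpa only [NNReal.coe_one, one_mul, Subtype.dist_eq] using
      (LipschitzWith.projIcc hab).dist_le_mul (I.2 i).1 (I.2 i).2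

theorem absolutelyContinuousOnInterval_trans [SeminormedAddCommGroup X] {f : ℝ → X}
    (hab : a ≤ b) (hbc : b ≤ c) (hf : AbsolutelyContinuousOnInterval f a b)
    (hf' : AbsolutelyContinuousOnInterval f b c) : AbsolutelyContinuousOnInterval f a c := by
  refine absolutelyContinuousOnInterval_congr (fun t ht => ?_)
    (((absolutelyContinuousOnInterval_comp_projIcc hab hf a c).add
      (absolutelyContinuousOnInterval_comp_projIcc hbc hf' a c)).sub
      (absolutelyContinuousOnInterval_const (f b)))
  rw [uIcc_of_le (hab.trans hbc)] at ht
  simp only [Pi.add_apply, Pi.sub_apply]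
  rcases le_total t b with htb | htb
  · rw [projIcc_of_mem hab ⟨ht.1, htb⟩, projIcc_of_le_left hbc htb, add_sub_cancel_right]
  · rw [projIcc_of_right_le hab htb, projIcc_of_mem hbc ⟨htb, ht.2⟩, add_sub_cancel_left]

theorem sub_le_integral_of_ae_hasDerivAt_le {f f' g : ℝ → ℝ} (hab : a ≤ b)
    (hf : AbsolutelyContinuousOnInterval f a b)
    (h : ∀ᵐ t ∂(volume.restrict (Icc a b)), HasDerivAt f (f' t) t ∧ f' t ≤ g t)
    (hg : IntervalIntegrable g volume a b) : f b - f a ≤ ∫ t in a..b, g t := by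
  rw [← hf.integral_deriv_eq_sub]
  refine intervalIntegral.integral_mono_ae_restrict hab hf.intervalIntegrable_deriv hg ?_
  filter_upwards [h] with t ⟨hderiv, hle⟩
  rwa [hderiv.deriv]

theorem sub_le_mul_of_ae_hasDerivAt_le {f f' : ℝ → ℝ} {M : ℝ} (hab : a ≤ b)
    (hf : AbsolutelyContinuousOnInterval f a b)
    (h : ∀ᵐ t ∂(volume.restrict (Icc a b)), HasDerivAt f (f' t) t ∧ f' t ≤ M) :
    f b - f a ≤ M * (b - a) :=
  (sub_le_integral_of_ae_hasDerivAt_le hab hf h intervalIntegrable_const).trans_eq <| by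
    rw [intervalIntegral.integral_const, smul_eq_mul, mul_comm]

/-- Grönwall's inequality: `exp (k t) (f t - g)` is nonincreasing. -/
theorem le_exp_mul_add_of_ae_hasDerivAt_le {f f' : ℝ → ℝ} {k g : ℝ} (hab : a ≤ b)
    (hf : AbsolutelyContinuousOnInterval f a b)
    (h : ∀ᵐ t ∂(volume.restrict (Icc a b)), HasDerivAt f (f' t) t ∧ f' t ≤ -k * (f t - g)) :
    f b ≤ Real.exp (-k * (b - a)) * (f a - g) + g := by
  have hexp : AbsolutelyContinuousOnInterval (fun t => Real.exp (k * (t - a))) a b :=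
    ContDiffOn.absolutelyContinuousOnInterval (by fun_prop)
  have hmono := sub_le_mul_of_ae_hasDerivAt_le hab (M := 0)
    (hexp.mul (hf.sub (absolutelyContinuousOnInterval_const g)))
    (f' := fun t => Real.exp (k * (t - a)) * k * (f t - g) + Real.exp (k * (t - a)) * f' t) (by
      filter_upwards [h] with t ⟨hderiv, hle⟩
      have hderiv_exp : HasDerivAt (fun t => Real.exp (k * (t - a)))
          (Real.exp (k * (t - a)) * k) t := by
        simpa using (((hasDerivAt_id t).sub_const a).const_mul k).exp
      exact ⟨hderiv_exp.mul (hderiv.sub_const g), by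
        linarith [mul_le_mul_of_nonneg_left hle (Real.exp_pos (k * (t - a))).le]⟩)
  simp only [Pi.mul_apply, Pi.sub_apply, sub_self, mul_zero, Real.exp_zero, one_mul, zero_mul,
    sub_nonpos] at hmono
  calc f b = Real.exp (-k * (b - a)) * (Real.exp (k * (b - a)) * (f b - g)) + g := by
        rw [← mul_assoc, ← Real.exp_add, neg_mul, neg_add_cancel, Real.exp_zero]; ring
    _ ≤ Real.exp (-k * (b - a)) * (f a - g) + g := by gcongr

variable [NormedAddCommGroup X] [InnerProductSpace ℝ X] {f f' : ℝ → X}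

theorem norm_sub_le_mul_of_ae_norm_hasDerivAt_le {M : ℝ} (hM : 0 ≤ M) (hab : a ≤ b)
    (hf : AbsolutelyContinuousOnInterval f a b)
    (h : ∀ᵐ t ∂(volume.restrict (Icc a b)), HasDerivAt f (f' t) t ∧ ‖f' t‖ ≤ M) :
    ‖f b - f a‖ ≤ M * (b - a) := by
  let v := f b - f a
  have hsq := sub_le_mul_of_ae_hasDerivAt_le hab (M := ‖v‖ * M) (f' := fun t => inner ℝ v (f' t))
    (absolutelyContinuousOnInterval_comp_of_locallyLipschitz
      (innerSL ℝ v).lipschitz.locallyLipschitz hf) (by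
      filter_upwards [h] with t ⟨hderiv, hle⟩
      exact ⟨(innerSL ℝ v).hasFDerivAt.comp_hasDerivAt t hderiv,
        (real_inner_le_norm _ _).trans (mul_le_mul_of_nonneg_left hle (norm_nonneg _))⟩)
  rw [innerSL_apply_apply, innerSL_apply_apply, ← inner_sub_right, real_inner_self_eq_norm_mul_norm,
    mul_assoc] at hsq
  rcases (norm_nonneg v).eq_or_lt with hv | hv
  · exact hv.symm.le.trans (mul_nonneg hM (sub_nonneg.2 hab))
  · exact le_of_mul_le_mul_left hsq hv

theorem lipschitzOnWith_of_ae_norm_hasDerivAt_le {S : Set ℝ} [S.OrdConnected] {M : NNReal}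
    (hf : ∀ r ∈ S, ∀ s ∈ S, AbsolutelyContinuousOnInterval f r s)
    (h : ∀ᵐ t ∂(volume.restrict S), HasDerivAt f (f' t) t ∧ ‖f' t‖ ≤ M) :
    LipschitzOnWith M f S := by
  have hordered : ∀ r ∈ S, ∀ s ∈ S, r ≤ s → dist (f s) (f r) ≤ M * dist s r := by
    intro r hr s hs hrs
    rw [dist_eq_norm, Real.dist_eq, abs_of_nonneg (sub_nonneg.2 hrs)]
    exact norm_sub_le_mul_of_ae_norm_hasDerivAt_le M.coe_nonneg hrs (hf r hr s hs)
      (ae_restrict_of_ae_restrict_of_subset (OrdConnected.out inferInstance hr hs) h)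
  refine LipschitzOnWith.of_dist_le_mul fun r hr s hs => ?_
  rcases le_total r s with hrs | hrs
  · rw [dist_comm, dist_comm r]
    exact hordered r hr s hs hrs
  · exact hordered s hs r hr hrs

theorem one_add_norm_sq_le_of_ae_linear_growth {k : ℝ} (hk : 0 ≤ k) (hab : a ≤ b)
    (hf : AbsolutelyContinuousOnInterval f a b)
    (h : ∀ᵐ t ∂(volume.restrict (Icc a b)), HasDerivAt f (f' t) t ∧ ‖f' t‖ ≤ k * (1 + ‖f t‖)) :
    1 + ‖f b‖ ^ 2 ≤ Real.exp (4 * k * (b - a)) * (1 + ‖f a‖ ^ 2) := by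
  have hsmooth : LocallyLipschitz fun x : X => 1 + ‖x‖ ^ 2 :=
    ContDiff.locallyLipschitz (𝕂 := ℝ) (contDiff_const.add (contDiff_norm_sq ℝ))
  have hgronwall := le_exp_mul_add_of_ae_hasDerivAt_le hab (k := -(4 * k)) (g := 0)
    (f' := fun t => 2 * inner ℝ (f t) (f' t))
    (absolutelyContinuousOnInterval_comp_of_locallyLipschitz hsmooth hf) (by
      filter_upwards [h] with t ⟨hderiv, hle⟩
      refine ⟨hderiv.norm_sq.const_add 1, ?_⟩
      have hinner : inner ℝ (f t) (f' t) ≤ ‖f t‖ * (k * (1 + ‖f t‖)) :=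
        (real_inner_le_norm _ _).trans (mul_le_mul_of_nonneg_left hle (norm_nonneg _))
      nlinarith [mul_nonneg hk (sq_nonneg (1 - ‖f t‖)), mul_nonneg hk (sq_nonneg ‖f t‖)])
  simpa only [neg_neg, sub_zero, add_zero] using hgronwall

theorem exists_lipschitzOnWith_of_ae_linear_growth {k : ℝ} (hk : 0 ≤ k)
    (hf : ∀ r ∈ Ico a b, ∀ s ∈ Ico a b, AbsolutelyContinuousOnInterval f r s)
    (h : ∀ᵐ t ∂(volume.restrict (Ico a b)), HasDerivAt f (f' t) t ∧ ‖f' t‖ ≤ k * (1 + ‖f t‖)) :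
    ∃ K, LipschitzOnWith K f (Ico a b) := by
  let R := Real.exp (4 * k * (b - a)) * (1 + ‖f a‖ ^ 2)
  have hR : ∀ t ∈ Ico a b, 1 + ‖f t‖ ^ 2 ≤ R := by
    intro t ht
    refine (one_add_norm_sq_le_of_ae_linear_growth hk ht.1
      (hf a (left_mem_Ico.2 (ht.1.trans_lt ht.2)) t ht)
      (ae_restrict_of_ae_restrict_of_subset (Icc_subset_Ico_right ht.2) h)).trans ?_
    have := ht.2.le
    simp only [R]
    gcongr
  refine ⟨(k * (1 + R)).toNNReal, lipschitzOnWith_of_ae_norm_hasDerivAt_le (f' := f') hf ?_⟩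
  filter_upwards [h, ae_restrict_mem measurableSet_Ico] with t ⟨hderiv, hle⟩ ht
  refine ⟨hderiv, hle.trans (le_trans ?_ (Real.le_coe_toNNReal _))⟩
  gcongr
  nlinarith [hR t ht, sq_nonneg (‖f t‖ - 1)]

end AbsolutelyContinuous

/-! ## Lipschitz vector fields -/

section Lipschitz

variable {X Y : Type*} [NormedAddCommGroup X] [NormedAddCommGroup Y] {K : NNReal}

theorem norm_le_of_lipschitzWith {f : X → Y} (hf : LipschitzWith K f) (x : X) :
    ‖f x‖ ≤ (‖f 0‖ + K) * (1 + ‖x‖) := by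
  have hdist : ‖f x - f 0‖ ≤ K * ‖x‖ := by
    simpa only [dist_eq_norm, sub_zero] using hf.dist_le_mul x 0
  calc ‖f x‖ ≤ ‖f x - f 0‖ + ‖f 0‖ := norm_le_norm_sub_add _ _
    _ ≤ K * ‖x‖ + ‖f 0‖ + (‖f 0‖ * ‖x‖ + K) := by
      linarith [mul_nonneg (norm_nonneg (f 0)) (norm_nonneg x), K.coe_nonneg]
    _ = (‖f 0‖ + K) * (1 + ‖x‖) := by ring

variable {F : X → X}

theorem exists_isPicardLindelof_of_lipschitzWith (hF : LipschitzWith K F) (x₀ : X) :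
    ∃ h₀ > 0, ∀ (T h : ℝ) (hT : T ∈ Icc T (T + h)), h ≤ h₀ →
      ∃ M, IsPicardLindelof (fun _ => F) (⟨T, hT⟩ : Icc T (T + h)) x₀ 1 0 M K := by
  refine ⟨1 / (‖F x₀‖ + K + 1), by positivity, fun T h hT hh => ⟨‖F x₀‖₊ + K,
    fun _ _ => hF.lipschitzOnWith, fun x _ => continuousOn_const, fun _ _ x hx => ?_, ?_⟩⟩
  · have hdist : ‖F x - F x₀‖ ≤ K * 1 := by
      rw [← dist_eq_norm]
      exact hF.dist_le_mul_of_le (by simpa using hx)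
    push_cast
    linarith [norm_le_norm_sub_add (F x) (F x₀)]
  · have h0 : 0 ≤ h := by linarith [hT.2]
    rw [le_div_iff₀ (by positivity)] at hh
    simp only [add_sub_cancel_left, sub_self, max_eq_left h0]
    push_cast
    linarith

theorem exists_forall_hasDerivAt_Ioo_of_lipschitzWith [NormedSpace ℝ X] [CompleteSpace X]
    (hF : LipschitzWith K F) (x₀ : X) :
    ∃ h₀ > 0, ∀ (T : ℝ), ∀ h ∈ Icc 0 h₀, ∃ α : ℝ → X, α T = x₀ ∧
      AbsolutelyContinuousOnInterval α T (T + h) ∧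
      ∀ s ∈ Ioo T (T + h), HasDerivAt α (F (α s)) s := by
  obtain ⟨h₀, h₀_pos, hPL⟩ := exists_isPicardLindelof_of_lipschitzWith hF x₀
  refine ⟨h₀, h₀_pos, fun T h hh => ?_⟩
  have hT : T ≤ T + h := by linarith [hh.1]
  obtain ⟨M, hM⟩ := hPL T h (left_mem_Icc.2 hT) hh.2
  obtain ⟨α, hα₀, hα⟩ := hM.exists_eq_forall_mem_Icc_hasDerivWithinAt₀
  refine ⟨α, hα₀, ?_, fun s hs =>
    (hα s (Ioo_subset_Icc_self hs)).hasDerivAt (Icc_mem_nhds hs.1 hs.2)⟩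
  have hcont : ContinuousOn α (Icc T (T + h)) := fun s hs => (hα s hs).continuousWithinAt
  obtain ⟨C, hC⟩ := isCompact_Icc.exists_bound_of_continuousOn
    (hF.continuous.comp_continuousOn hcont)
  have hlip : LipschitzOnWith C.toNNReal α (Icc T (T + h)) := by
    refine (convex_Icc _ _).lipschitzOnWith_of_nnnorm_hasDerivWithin_le hα fun s hs => ?_
    rw [← NNReal.coe_le_coe, coe_nnnorm]
    exact (hC s hs).trans (Real.le_coe_toNNReal C)
  rw [← uIcc_of_le hT] at hlip
  exact hlip.absolutelyContinuousOnInterval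

end Lipschitz

/-! ## Hybrid time domains -/

/-- The sequence of jump times of a hybrid time domain: `t j` is the left end of the `j`-th interval
whenever that interval is nonempty; the later values of `t` carry no information. -/
structure HasJumpTimes (E : Set (ℝ × ℕ)) (t : ℕ → ℝ) : Prop where
  zero : t 0 = 0
  mono : Monotone t
  origin : (0, 0) ∈ E
  ordConnected : ∀ j, (timeSlice E j).OrdConnected
  isLeast : ∀ {s j}, (s, j) ∈ E → IsLeast (timeSlice E j) (t j)
  prev : ∀ {s j}, (s, j) ∈ E → ∀ {k}, k < j → timeSlice E k = Icc (t k) (t (k + 1))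

theorem IsHybridTimeDomain.exists_hasJumpTimes {E : Set (ℝ × ℕ)} (hE : IsHybridTimeDomain E) :
    ∃ t, HasJumpTimes E t := by
  obtain ⟨t, h0, hmono, h⟩ := hE
  have hle : ∀ j, t j ≤ t (j + 1) := fun j => hmono j.le_succ
  have hprev : ∀ {s j}, (s, j) ∈ E → ∀ {k}, k < j → timeSlice E k = Icc (t k) (t (k + 1)) := by
    intro s j hs k hk
    rcases h with h | ⟨J, hbefore, -, hafter⟩
    · exact h k
    · exact hbefore k (hk.trans_le (le_of_not_gt fun hj => (hafter j hj ▸ hs : s ∈ (∅ : Set ℝ))))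
  have hcases : ∀ j, timeSlice E j = ∅ ∧ j ≠ 0 ∨
      (timeSlice E j).OrdConnected ∧ IsLeast (timeSlice E j) (t j) := by
    intro j
    have hIcc : timeSlice E j = Icc (t j) (t (j + 1)) →
        (timeSlice E j).OrdConnected ∧ IsLeast (timeSlice E j) (t j) := fun hj =>
      hj ▸ ⟨ordConnected_Icc, isLeast_Icc (hle j)⟩
    rcases h with h | ⟨J, hbefore, hlast, hafter⟩
    · exact Or.inr (hIcc (h j))
    rcases lt_trichotomy j J with hj | rfl | hj
    · exact Or.inr (hIcc (hbefore j hj))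
    · rcases hlast with hlast | ⟨hlt, hlast⟩ | hlast
      exacts [Or.inr (hIcc hlast), Or.inr (hlast ▸ ⟨ordConnected_Ico, isLeast_Ico hlt⟩),
        Or.inr (hlast ▸ ⟨ordConnected_Ici, isLeast_Ici⟩)]
    · exact Or.inl ⟨hafter j hj, by lia⟩
  refine ⟨t, h0, hmono, ?_, fun j => ?_, fun {s j} hs => ?_, hprev⟩
  · exact h0 ▸ ((hcases 0).resolve_left fun h => h.2 rfl).2.1
  · exact (hcases j).elim (fun h => h.1 ▸ ordConnected_empty) And.left
  · exact ((hcases j).resolve_left fun h => (h.1 ▸ hs : s ∈ (∅ : Set ℝ))).2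

theorem le_exp_mul_add_trans {a b c d x y v G : ℝ} (hx : x ≤ Real.exp (-c * a) * v + G + d)
    (hy : y ≤ Real.exp (-c * (b - a)) * (x - G) + G) :
    y ≤ Real.exp (-c * b) * v + G + Real.exp (-c * (b - a)) * d := by
  have hexp : Real.exp (-c * b) = Real.exp (-c * (b - a)) * Real.exp (-c * a) := by
    rw [← Real.exp_add]; ring_nf
  rw [hexp]
  linarith [mul_le_mul_of_nonneg_left hx (Real.exp_pos (-c * (b - a))).le]

namespace HasJumpTimes

variable {E : Set (ℝ × ℕ)} {t : ℕ → ℝ} {r s : ℝ} {j : ℕ}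

theorem le (h : HasJumpTimes E t) (hs : (s, j) ∈ E) : t j ≤ s := (h.isLeast hs).2 hs

theorem start_mem (h : HasJumpTimes E t) (hs : (s, j) ∈ E) : (t j, j) ∈ E := (h.isLeast hs).1

theorem Icc_subset (h : HasJumpTimes E t) (hr : t j ≤ r) (hs : (s, j) ∈ E) :
    Icc r s ⊆ timeSlice E j :=
  (Icc_subset_Icc_left hr).trans ((h.ordConnected j).out (h.start_mem hs) hs)

theorem end_mem (h : HasJumpTimes E t) (hs : (s, j + 1) ∈ E) : (t (j + 1), j) ∈ E := by
  change t (j + 1) ∈ timeSlice E j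
  rw [h.prev hs j.lt_succ_self]
  exact right_mem_Icc.2 (h.mono j.le_succ)

theorem jump_mem (h : HasJumpTimes E t) (hs : (s, j + 1) ∈ E) : (t (j + 1), j) ∈ jumpPoints E :=
  ⟨h.end_mem hs, h.start_mem hs⟩

theorem eq_of_mem_jumpPoints (h : HasJumpTimes E t) (hs : (s, j) ∈ jumpPoints E) :
    s = t (j + 1) := by
  have hmem : s ∈ timeSlice E j := hs.1
  rw [h.prev hs.2 j.lt_succ_self] at hmem
  exact le_antisymm hmem.2 (h.le hs.2)

theorem jumpTime_nonneg (h : HasJumpTimes E t) (j : ℕ) : 0 ≤ t j := h.zero ▸ h.mono j.zero_le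

theorem nonneg (h : HasJumpTimes E t) (hs : (s, j) ∈ E) : 0 ≤ s :=
  (h.jumpTime_nonneg j).trans (h.le hs)

theorem firstCounter_eq (h : HasJumpTimes E t) (hs : (s, j) ∈ E) (hr : r ∈ Ioc (t j) s) :
    firstCounter E r = j := by
  have hmem : (r, j) ∈ E := h.Icc_subset le_rfl hs (Ioc_subset_Icc_self hr)
  refine le_antisymm (Nat.sInf_le hmem) (le_csInf ⟨j, hmem⟩ fun k hk => le_of_not_gt fun hkj => ?_)
  replace hk : r ∈ timeSlice E k := hk
  rw [h.prev hs hkj] at hk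
  exact (hk.2.trans (h.mono hkj)).not_gt hr.1

theorem Icc_subset_ordinaryTimes (h : HasJumpTimes E t) (hs : (s, j) ∈ E) :
    Icc 0 s ⊆ ordinaryTimes E := by
  intro r hr
  induction j generalizing s with
  | zero => exact ⟨0, h.Icc_subset h.zero.le hs hr⟩
  | succ j ih =>
    rcases le_total r (t (j + 1)) with hrt | hrt
    · exact ih (h.end_mem hs) ⟨hr.1, hrt⟩
    · exact ⟨j + 1, h.Icc_subset le_rfl hs ⟨hrt, hr.2⟩⟩

theorem exists_monotone_ordinaryTimes_eq_iUnion (h : HasJumpTimes E t) : ∃ x : ℕ → ℝ, Monotone x ∧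
    (∀ n, x n ∈ ordinaryTimes E) ∧ ordinaryTimes E = ⋃ n, Icc 0 (x n) := by
  have : (ordinaryTimes E).OrdConnected := ⟨fun _ ⟨_, ha⟩ _ ⟨_, hb⟩ _ hr =>
    h.Icc_subset_ordinaryTimes hb ⟨(h.nonneg ha).trans hr.1, hr.2⟩⟩
  have : Nonempty (ordinaryTimes E) := ⟨⟨0, 0, h.origin⟩⟩
  obtain ⟨x, hx, hxt⟩ := Filter.exists_seq_monotone_tendsto_atTop_atTop (ordinaryTimes E)
  refine ⟨fun n => x n, fun m n hmn => hx hmn, fun n => (x n).2,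
    subset_antisymm (fun r hr => ?_) (iUnion_subset fun n => ?_)⟩
  · obtain ⟨n, hn⟩ := (hxt.eventually (Filter.eventually_ge_atTop ⟨r, hr⟩)).exists
    obtain ⟨j, hj⟩ := hr
    exact mem_iUnion.2 ⟨n, h.nonneg hj, hn⟩
  · obtain ⟨j, hj⟩ := (x n).2
    exact h.Icc_subset_ordinaryTimes hj

theorem mul_counter_le (h : HasJumpTimes E t) {T : ℝ} (hT : 0 ≤ T)
    (hdwell : ∀ s j, (s, j + 2) ∈ E → T ≤ t (j + 2) - t (j + 1)) (hs : (s, j) ∈ E) :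
    T * j ≤ s + T := by
  refine le_trans ?_ (add_le_add_left (h.le hs) T)
  induction j generalizing s with
  | zero => simpa [h.zero] using hT
  | succ j ih =>
    cases j with
    | zero => simpa using h.jumpTime_nonneg 1
    | succ j =>
      have := ih (h.end_mem hs)
      have := hdwell s j hs
      push_cast at *
      linarith

/-- Each jump contributes `p`, and the dwell time `T` makes the contributions of successive jumps
decay by the factor `exp (-c T)`, so that together they stay below the geometric series
`p / (1 - exp (-c T))`. -/
theorem le_exp_mul_add_of_dwell (h : HasJumpTimes E t) {V : ℝ → ℕ → ℝ} {c G p T : ℝ}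
    (hc : 0 < c) (hT : 0 < T) (hp : 0 ≤ p)
    (hdwell : ∀ s j, (s, j + 2) ∈ E → T ≤ t (j + 2) - t (j + 1))
    (hflow : ∀ s j, (s, j) ∈ E → V s j ≤ Real.exp (-c * (s - t j)) * (V (t j) j - G) + G)
    (hjump : ∀ s j, (s, j) ∈ jumpPoints E → V s (j + 1) ≤ V s j + p) (hs : (s, j) ∈ E) :
    V s j ≤ Real.exp (-c * s) * (V 0 0 - G) + G + p / (1 - Real.exp (-c * T)) := by
  set q := p / (1 - Real.exp (-c * T))
  have hexp : Real.exp (-c * T) < 1 := Real.exp_lt_one_iff.2 (by nlinarith)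
  have hq : 0 ≤ q := div_nonneg hp (sub_nonneg.2 hexp.le)
  have hgeom : Real.exp (-c * T) * q + p = q := by
    have := div_mul_cancel₀ p (sub_pos.2 hexp).ne'
    linarith
  have hslice : ∀ {s j} {d : ℝ}, (s, j) ∈ E →
      V (t j) j ≤ Real.exp (-c * t j) * (V 0 0 - G) + G + d →
      V s j ≤ Real.exp (-c * s) * (V 0 0 - G) + G + Real.exp (-c * (s - t j)) * d :=
    fun hs hj => le_exp_mul_add_trans hj (hflow _ _ hs)
  have hfirst : ∀ {s}, (s, 0) ∈ E → V s 0 ≤ Real.exp (-c * s) * (V 0 0 - G) + G := fun hs => by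
    simpa [h.zero] using hflow _ 0 hs
  have hstart : ∀ {j s}, (s, j + 1) ∈ E →
      V (t (j + 1)) (j + 1) ≤ Real.exp (-c * t (j + 1)) * (V 0 0 - G) + G + q := by
    intro j
    induction j with
    | zero =>
      intro s hs
      linarith [hfirst (h.end_mem hs), hjump _ _ (h.jump_mem hs),
        mul_nonneg (Real.exp_pos (-c * T)).le hq]
    | succ j ih =>
      intro s hs
      have hdecay : Real.exp (-c * (t (j + 2) - t (j + 1))) * q ≤ Real.exp (-c * T) * q :=
        mul_le_mul_of_nonneg_right (Real.exp_le_exp.2 (by nlinarith [hdwell s j hs])) hq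
      linarith [hslice (h.end_mem hs) (ih (h.end_mem hs)), hjump _ _ (h.jump_mem hs)]
  cases j with
  | zero => linarith [hfirst hs]
  | succ j =>
    have hle : Real.exp (-c * (s - t (j + 1))) ≤ 1 :=
      Real.exp_le_one_iff.2 (by nlinarith [h.le hs])
    linarith [hslice hs (hstart hs), mul_le_of_le_one_left hq hle]

theorem lintegral_Ioc_firstCounter (h : HasJumpTimes E t) (hs : (s, j) ∈ E) (f : ℝ → ℕ → ℝ≥0∞) :
    ∫⁻ r in Ioc 0 s, f r (firstCounter E r) =
      (∫⁻ r in Ioc 0 (t j), f r (firstCounter E r)) + ∫⁻ r in Ioc (t j) s, f r j := by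
  rw [← Ioc_union_Ioc_eq_Ioc (h.jumpTime_nonneg j) (h.le hs),
    lintegral_union measurableSet_Ioc (Ioc_disjoint_Ioc_of_le le_rfl)]
  congr 1
  exact setLIntegral_congr_fun measurableSet_Ioc fun r hr => by
    simp only [h.firstCounter_eq hs hr]

theorem add_lintegral_firstCounter_le (h : HasJumpTimes E t) {V f g : ℝ → ℕ → ℝ≥0∞}
    (hflow : ∀ s j, (s, j) ∈ E →
      V s j + ∫⁻ r in Ioc (t j) s, f r j ≤ V (t j) j + ∫⁻ r in Ioc (t j) s, g r j)
    (hjump : ∀ s j, (s, j) ∈ jumpPoints E → V s (j + 1) ≤ V s j) (hs : (s, j) ∈ E) :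
    V s j + ∫⁻ r in Ioc 0 s, f r (firstCounter E r) ≤
      V 0 0 + ∫⁻ r in Ioc 0 s, g r (firstCounter E r) := by
  have hslice : ∀ {s j}, (s, j) ∈ E →
      V (t j) j + ∫⁻ r in Ioc 0 (t j), f r (firstCounter E r) ≤
        V 0 0 + ∫⁻ r in Ioc 0 (t j), g r (firstCounter E r) →
      V s j + ∫⁻ r in Ioc 0 s, f r (firstCounter E r) ≤
        V 0 0 + ∫⁻ r in Ioc 0 s, g r (firstCounter E r) := by
    intro s j hs hstart
    rw [h.lintegral_Ioc_firstCounter hs f, h.lintegral_Ioc_firstCounter hs g, ← add_assoc]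
    calc V s j + _ + _ = V s j + (∫⁻ r in Ioc (t j) s, f r j) +
            ∫⁻ r in Ioc 0 (t j), f r (firstCounter E r) := add_right_comm _ _ _
      _ ≤ V (t j) j + (∫⁻ r in Ioc (t j) s, g r j) +
            ∫⁻ r in Ioc 0 (t j), f r (firstCounter E r) := add_le_add_left (hflow s j hs) _
      _ = V (t j) j + (∫⁻ r in Ioc 0 (t j), f r (firstCounter E r)) +
            ∫⁻ r in Ioc (t j) s, g r j := add_right_comm _ _ _
      _ ≤ V 0 0 + (∫⁻ r in Ioc 0 (t j), g r (firstCounter E r)) +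
            ∫⁻ r in Ioc (t j) s, g r j := add_le_add_left hstart _
      _ = _ := add_assoc _ _ _
  induction j generalizing s with
  | zero => exact hslice hs (by simp [h.zero])
  | succ j ih =>
    exact hslice hs ((add_le_add_left (hjump _ _ (h.jump_mem hs)) _).trans (ih (h.end_mem hs)))

theorem l2Norm_eq_iSup {V : Type*} [NormedAddCommGroup V] (h : HasJumpTimes E t)
    (u : ℝ → ℕ → V) :
    l2Norm E u = (⨆ s ∈ ordinaryTimes E,
      ∫⁻ r in Ioc 0 s, ‖u r (firstCounter E r)‖ₑ ^ (2 : ℝ)) ^ (1 / 2 : ℝ) := by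
  obtain ⟨x, hx, hmem, hU⟩ := h.exists_monotone_ordinaryTimes_eq_iUnion
  rw [l2Norm, eLpNorm_eq_lintegral_rpow_enorm_toReal (by norm_num) (by norm_num),
    ENNReal.toReal_ofNat]
  congr 1
  simp only [setLIntegral_congr (μ := volume) (Ioc_ae_eq_Icc (α := ℝ))]
  refine le_antisymm ?_ (iSup₂_le fun s ⟨j, hj⟩ =>
    lintegral_mono_set (h.Icc_subset_ordinaryTimes hj))
  nth_rewrite 1 [hU]
  rw [setLIntegral_iUnion_of_directed _
    (Monotone.directed_le fun m n hmn => Icc_subset_Icc_right (hx hmn))]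
  exact iSup_le fun n => le_iSup₂ (f := fun s (_ : s ∈ ordinaryTimes E) =>
    ∫⁻ r in Icc 0 s, ‖u r (firstCounter E r)‖ₑ ^ (2 : ℝ)) (x n) (hmem n)

end HasJumpTimes

/-- A hybrid time domain with at most `J` jumps, the `j`-th of them at time `t j`. -/
structure IsFiniteDomain (E : Set (ℝ × ℕ)) (t : ℕ → ℝ) (J : ℕ) : Prop where
  zero : t 0 = 0
  mono : Monotone t
  slice : ∀ j < J, timeSlice E j = Icc (t j) (t (j + 1))
  empty : ∀ j, J < j → timeSlice E j = ∅

theorem IsHybridTimeDomain.exists_isFiniteDomain_of_not_isCompleteDomain {E : Set (ℝ × ℕ)}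
    (hE : IsHybridTimeDomain E) (hc : ¬ IsCompleteDomain E) :
    ∃ t J, IsFiniteDomain E t J ∧ (timeSlice E J = Icc (t J) (t (J + 1)) ∨
      (t J < t (J + 1) ∧ timeSlice E J = Ico (t J) (t (J + 1)))) := by
  obtain ⟨t, h0, hmono, h | ⟨J, hbefore, hlast, hafter⟩⟩ := hE
  · refine absurd (fun M => ?_) hc
    obtain ⟨n, hn⟩ := exists_nat_gt M
    have hmem : t n ∈ timeSlice E n := h n ▸ left_mem_Icc.2 (hmono n.le_succ)
    exact ⟨(t n, n), hmem, hn.trans_le (le_add_of_nonneg_left (h0 ▸ hmono n.zero_le))⟩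
  · refine ⟨t, J, ⟨h0, hmono, hbefore, hafter⟩, ?_⟩
    rcases hlast with hlast | hlast | hlast
    · exact Or.inl hlast
    · exact Or.inr hlast
    · refine absurd (fun M => ?_) hc
      have hmem : max (t J) (M + 1) ∈ timeSlice E J := hlast ▸ mem_Ici.2 (le_max_left _ _)
      exact ⟨(max (t J) (M + 1), J), hmem, (lt_add_one M).trans_le
        ((le_max_right _ _).trans (le_add_of_nonneg_right J.cast_nonneg))⟩

/-! ## Solution pairs -/

section LinfNorm

variable {V : Type*} [NormedAddCommGroup V] {E : Set (ℝ × ℕ)} {u : ℝ → ℕ → V}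

theorem norm_le_of_enorm_le_linfNorm (hu : linfNorm E u < ∞) {v : V} (hv : ‖v‖ₑ ≤ linfNorm E u) :
    ‖v‖ ≤ (linfNorm E u).toReal := by
  rw [← toReal_enorm]
  exact ENNReal.toReal_mono hu.ne hv

theorem ae_norm_le_linfNorm {t : ℕ → ℝ} (hE : HasJumpTimes E t) (hu : linfNorm E u < ∞) (j : ℕ) :
    ∀ᵐ s ∂(volume.restrict (timeSlice E j)), ‖u s j‖ ≤ (linfNorm E u).toReal := by
  have hslice : (timeSlice (E \ jumpPoints E) j : Set ℝ) =ᵐ[volume] timeSlice E j := by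
    have hne : ∀ᵐ s : ℝ, s ≠ t (j + 1) := by simp [ae_iff, measure_singleton]
    filter_upwards [hne] with s hs
    exact propext ⟨And.left, fun hmem => ⟨hmem, fun h => hs (hE.eq_of_mem_jumpPoints h)⟩⟩
  rw [← Measure.restrict_congr_set hslice]
  filter_upwards [ae_le_essSup (μ := volume.restrict (timeSlice (E \ jumpPoints E) j))
    (f := fun s => ‖u s j‖ₑ)] with s hs
  exact norm_le_of_enorm_le_linfNorm hu (hs.trans ((le_iSup (fun j => essSup (fun t => ‖u t j‖ₑ)
    (volume.restrict (timeSlice (E \ jumpPoints E) j))) j).trans (le_max_left _ _)))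

theorem norm_le_linfNorm (hu : linfNorm E u < ∞) {s : ℝ} {j : ℕ} (hs : (s, j) ∈ jumpPoints E) :
    ‖u s j‖ ≤ (linfNorm E u).toReal :=
  norm_le_of_enorm_le_linfNorm hu ((le_iSup₂ (f := fun (p : ℝ × ℕ) (_ : p ∈ jumpPoints E) =>
    ‖u p.1 p.2‖ₑ) (s, j) hs).trans (le_max_right _ _))

end LinfNorm

section PairInput

variable {W Y : Type*} [NormedAddCommGroup W] [NormedAddCommGroup Y]

theorem norm_le_norm_pairInput_left (w : ℝ → ℕ → W) (η : ℝ → ℕ → Y) (s : ℝ) (j : ℕ) :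
    ‖w s j‖ ≤ ‖pairInput w η s j‖ :=
  WithLp.norm_fst_le (x := pairInput w η s j)

theorem norm_le_norm_pairInput_right (w : ℝ → ℕ → W) (η : ℝ → ℕ → Y) (s : ℝ) (j : ℕ) :
    ‖η s j‖ ≤ ‖pairInput w η s j‖ :=
  WithLp.norm_snd_le (x := pairInput w η s j)

end PairInput

theorem IsHybridInput.integrableOn_norm_sq {V : Type*} [NormedAddCommGroup V] {E : Set (ℝ × ℕ)}
    {u : ℝ → ℕ → V} {j : ℕ} {a b : ℝ} (hu : IsHybridInput E u) (hsub : Icc a b ⊆ timeSlice E j) :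
    IntegrableOn (fun s => ‖u s j‖ ^ 2) (Icc a b) := by
  obtain ⟨M, hM⟩ := (hu j).2 _ isCompact_Icc hsub
  refine Integrable.of_bound
    (((hu j).1.mono_measure (Measure.restrict_mono hsub le_rfl)).norm.pow 2) (M ^ 2) ?_
  filter_upwards [hM] with s hs
  rw [norm_pow, norm_norm]
  exact pow_le_pow_left₀ (norm_nonneg _) hs 2

theorem mem_of_ae_mem_of_isClosed {X : Type*} [TopologicalSpace X] {f : ℝ → X} {C : Set X}
    {a b x : ℝ} (hab : a < b) (hf : ContinuousOn f (Icc a b)) (hC : IsClosed C)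
    (h : ∀ᵐ s ∂(volume.restrict (Icc a b)), f s ∈ C) (hx : x ∈ Icc a b) : f x ∈ C := by
  have hopen : IsOpen (Ioo a b ∩ f ⁻¹' Cᶜ) :=
    (hf.mono Ioo_subset_Icc_self).isOpen_inter_preimage isOpen_Ioo hC.isOpen_compl
  have hempty : Ioo a b ∩ f ⁻¹' Cᶜ = ∅ := by
    rw [← hopen.measure_eq_zero_iff volume]
    refine measure_mono_null (fun s hs => ?_) (ae_iff.1 ((ae_restrict_iff' measurableSet_Icc).1 h))
    exact fun h => hs.2 (h (Ioo_subset_Icc_self hs.1))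
  have hmaps : MapsTo f (Ioo a b) C := fun s hs => by
    by_contra hsC
    exact hempty.subset ⟨hs, hsC⟩
  rw [← closure_Ioo hab.ne] at hx hf
  exact hC.closure_subset (hmaps.closure_of_continuousOn hf hx)

/-- All states reached by solutions belong to the flow set, because jumps start and end there. -/
structure HybridSystem.HasInvariantFlowSet {X W Y : Type*} [TopologicalSpace X]
    (Sys : HybridSystem X W Y) : Prop where
  isClosed : IsClosed Sys.flowSet
  jumpSet_subset : Sys.jumpSet ⊆ Sys.flowSet
  jump_subset : ∀ x ∈ Sys.jumpSet, ∀ η, Sys.jump x η ⊆ Sys.flowSet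

namespace IsSolutionPair

variable {X W Y : Type*} [NormedAddCommGroup X] [NormedSpace ℝ X]
    [NormedAddCommGroup W] [NormedAddCommGroup Y] {Sys : HybridSystem X W Y}
    {E : Set (ℝ × ℕ)} {φ : ℝ → ℕ → X} {w : ℝ → ℕ → W} {η : ℝ → ℕ → Y} {t : ℕ → ℝ} {s : ℝ} {j : ℕ}

theorem absolutelyContinuousOnInterval (h : IsSolutionPair Sys E φ w η) (hE : HasJumpTimes E t)
    (hs : (s, j) ∈ E) : AbsolutelyContinuousOnInterval (fun r => φ r j) (t j) s :=
  h.arc j (t j) (hE.start_mem hs) s hs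

theorem ae_flow (h : IsSolutionPair Sys E φ w η) (hE : HasJumpTimes E t) (hs : (s, j) ∈ E) :
    ∀ᵐ r ∂(volume.restrict (Icc (t j) s)),
      φ r j ∈ Sys.flowSet ∧ HasDerivAt (fun r => φ r j) (Sys.flow (φ r j) (w r j)) r :=
  ae_restrict_of_ae_restrict_of_subset (hE.Icc_subset le_rfl hs) (h.flows j)

theorem mem_flowSet (h : IsSolutionPair Sys E φ w η) (hSys : Sys.HasInvariantFlowSet)
    (hs : (s, j) ∈ E) : φ s j ∈ Sys.flowSet := by
  obtain ⟨t, hE⟩ := h.timeDomain.exists_hasJumpTimes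
  rcases (hE.le hs).eq_or_lt with rfl | hlt
  · cases j with
    | zero =>
      rw [hE.zero]
      exact h.initial.elim id fun hx => hSys.jumpSet_subset hx
    | succ j =>
      obtain ⟨hjump, hmem⟩ := h.jumps _ _ (hE.jump_mem hs)
      exact hSys.jump_subset _ hjump _ hmem
  · have hcont := (h.absolutelyContinuousOnInterval hE hs).continuousOn
    rw [uIcc_of_le hlt.le] at hcont
    exact mem_of_ae_mem_of_isClosed hlt hcont hSys.isClosed
      ((h.ae_flow hE hs).mono fun _ => And.left) (right_mem_Icc.2 hlt.le)

end IsSolutionPair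

/-- Along solutions, consecutive jumps are separated by at least `T` units of ordinary time. -/
def HybridSystem.HasDwellTime {X W Y : Type*} [NormedAddCommGroup X] [NormedSpace ℝ X]
    [NormedAddCommGroup W] [NormedAddCommGroup Y] (Sys : HybridSystem X W Y) (T : ℝ) : Prop :=
  ∀ E φ w η t, IsSolutionPair Sys E φ w η → HasJumpTimes E t →
    ∀ s j, (s, j + 2) ∈ E → T ≤ t (j + 2) - t (j + 1)

theorem HybridSystem.HasDwellTime.exp_neg_mul_le {X W Y : Type*} [NormedAddCommGroup X]
    [NormedSpace ℝ X] [NormedAddCommGroup W] [NormedAddCommGroup Y] {Sys : HybridSystem X W Y}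
    {T lam : ℝ} (hdwell : Sys.HasDwellTime T) (hT : 0 < T) (hlam : 0 ≤ lam) {E : Set (ℝ × ℕ)}
    {φ : ℝ → ℕ → X} {w : ℝ → ℕ → W} {η : ℝ → ℕ → Y} (h : IsSolutionPair Sys E φ w η)
    {s : ℝ} {j : ℕ} (hs : (s, j) ∈ E) :
    Real.exp (-lam * s) ≤
      Real.exp (lam * T / (1 + T)) * Real.exp (-(lam * T / (1 + T)) * (s + j)) := by
  obtain ⟨t, hE⟩ := h.timeDomain.exists_hasJumpTimes
  have hcounter : T * j ≤ s + T := hE.mul_counter_le hT.le (hdwell E φ w η t h hE) hs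
  rw [← Real.exp_add, Real.exp_le_exp]
  have hrate : lam * T / (1 + T) * (s + j) - lam * T / (1 + T) - lam * s =
      lam / (1 + T) * (T * j - (s + T)) := by
    field_simp
    ring
  have := mul_nonpos_of_nonneg_of_nonpos (by positivity : 0 ≤ lam / (1 + T)) (sub_nonpos.2 hcounter)
  linarith

/-! ## Storage functions -/

/-- `V` certifies both exponential decay towards `𝒜` at rate `lam` and an `L²`-gain of at most `γ`
from `w` to the output `h`: it is comparable with the squared distance to `𝒜`, decreases along flows
at rate `2 * lam` up to the supply rate `γ² |w|² - |h|²`, and grows at jumps at most by a multiple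
of `|η|²`. -/
structure IsStorageFunction {X W Y Z : Type*} [NormedAddCommGroup X] [NormedSpace ℝ X]
    [NormedAddCommGroup W] [NormedAddCommGroup Y] [NormedAddCommGroup Z]
    (Sys : HybridSystem X W Y) (𝒜 : Set X) (h : X → Z) (lam γ : ℝ) (V : X → ℝ) : Prop where
  contDiff : ContDiff ℝ 1 V
  lower : ∃ m > 0, ∀ x ∈ Sys.flowSet, m * Metric.infDist x 𝒜 ^ 2 ≤ V x
  upper : ∃ M > 0, ∀ x ∈ Sys.flowSet, V x ≤ M * Metric.infDist x 𝒜 ^ 2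
  flow : ∀ x ∈ Sys.flowSet, ∀ w,
    fderiv ℝ V x (Sys.flow x w) ≤ -(2 * lam) * V x - ‖h x‖ ^ 2 + γ ^ 2 * ‖w‖ ^ 2
  jump : ∃ p, 0 ≤ p ∧ ∀ x ∈ Sys.jumpSet, ∀ η, ∀ g ∈ Sys.jump x η, V g ≤ V x + p * ‖η‖ ^ 2

theorem le_sqrt_mul_add_sqrt_mul_of_mul_sq_le {m M D x y z : ℝ} (hm : 0 < m) (hM : 0 ≤ M)
    (hD : 0 ≤ D) (hy : 0 ≤ y) (hz : 0 ≤ z) (h : m * x ^ 2 ≤ M * y ^ 2 + D * z ^ 2) :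
    x ≤ √(M / m) * y + √(D / m) * z := by
  refine le_of_abs_le (abs_le_of_sq_le_sq ?_ (by positivity))
  calc x ^ 2 ≤ M / m * y ^ 2 + D / m * z ^ 2 := by
        rw [div_mul_eq_mul_div, div_mul_eq_mul_div, ← add_div, le_div_iff₀' hm]
        exact h
    _ = (√(M / m) * y) ^ 2 + (√(D / m) * z) ^ 2 := by
        rw [mul_pow, mul_pow, Real.sq_sqrt (by positivity), Real.sq_sqrt (by positivity)]
    _ ≤ (√(M / m) * y + √(D / m) * z) ^ 2 := by
        rw [add_sq']
        exact le_add_of_nonneg_right (by positivity)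

theorem lintegral_enorm_sq_eq_ofReal_integral {V : Type*} [NormedAddCommGroup V] {f : ℝ → V}
    {s : Set ℝ} (hf : IntegrableOn (fun x => ‖f x‖ ^ 2) s) :
    ∫⁻ x in s, ‖f x‖ₑ ^ (2 : ℝ) = ENNReal.ofReal (∫ x in s, ‖f x‖ ^ 2) := by
  rw [ofReal_integral_eq_lintegral_ofReal hf (ae_of_all _ fun x => sq_nonneg _)]
  refine lintegral_congr fun x => ?_
  rw [← ofReal_norm, ENNReal.ofReal_rpow_of_nonneg (norm_nonneg _) (by norm_num), Real.rpow_two]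

namespace IsStorageFunction

variable {X W Y Z : Type*} [NormedAddCommGroup X] [NormedSpace ℝ X]
  [NormedAddCommGroup W] [NormedAddCommGroup Y] [NormedAddCommGroup Z] {Sys : HybridSystem X W Y}
  {𝒜 : Set X} {h : X → Z} {lam γ T : ℝ} {V : X → ℝ} {E : Set (ℝ × ℕ)} {φ : ℝ → ℕ → X}
  {w : ℝ → ℕ → W} {η : ℝ → ℕ → Y} {t : ℕ → ℝ} {s : ℝ} {j : ℕ}

theorem nonneg (hV : IsStorageFunction Sys 𝒜 h lam γ V) {x : X} (hx : x ∈ Sys.flowSet) :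
    0 ≤ V x := by
  obtain ⟨m, hm, hlower⟩ := hV.lower
  exact (mul_nonneg hm.le (sq_nonneg _)).trans (hlower x hx)

theorem absolutelyContinuousOnInterval (hV : IsStorageFunction Sys 𝒜 h lam γ V)
    (hφ : IsSolutionPair Sys E φ w η) (hE : HasJumpTimes E t) (hs : (s, j) ∈ E) :
    AbsolutelyContinuousOnInterval (fun r => V (φ r j)) (t j) s :=
  absolutelyContinuousOnInterval_comp_of_locallyLipschitz hV.contDiff.locallyLipschitz
    (hφ.absolutelyContinuousOnInterval hE hs)

theorem ae_dissipation (hV : IsStorageFunction Sys 𝒜 h lam γ V)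
    (hφ : IsSolutionPair Sys E φ w η) (hE : HasJumpTimes E t) (hs : (s, j) ∈ E) :
    ∀ᵐ r ∂(volume.restrict (Icc (t j) s)),
      HasDerivAt (fun r => V (φ r j)) (fderiv ℝ V (φ r j) (Sys.flow (φ r j) (w r j))) r ∧
      fderiv ℝ V (φ r j) (Sys.flow (φ r j) (w r j)) ≤
        -(2 * lam) * V (φ r j) - ‖h (φ r j)‖ ^ 2 + γ ^ 2 * ‖w r j‖ ^ 2 :=
  (hφ.ae_flow hE hs).mono fun r ⟨hmem, hderiv⟩ =>
    ⟨((hV.contDiff.differentiable one_ne_zero).differentiableAt.hasFDerivAt).comp_hasDerivAt r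
      hderiv, hV.flow _ hmem _⟩

/-! ### Exponential bounds -/

theorem le_exp_mul_add_of_flow (hV : IsStorageFunction Sys 𝒜 h lam γ V) (hlam : lam ≠ 0)
    (hφ : IsSolutionPair Sys E φ w η) (hE : HasJumpTimes E t) {μ : ℝ}
    (hw : ∀ᵐ r ∂(volume.restrict (timeSlice E j)), ‖w r j‖ ≤ μ) (hs : (s, j) ∈ E) :
    V (φ s j) ≤ Real.exp (-(2 * lam) * (s - t j)) *
      (V (φ (t j) j) - γ ^ 2 / (2 * lam) * μ ^ 2) + γ ^ 2 / (2 * lam) * μ ^ 2 := by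
  refine le_exp_mul_add_of_ae_hasDerivAt_le
    (f' := fun r => fderiv ℝ V (φ r j) (Sys.flow (φ r j) (w r j))) (hE.le hs)
    (hV.absolutelyContinuousOnInterval hφ hE hs) ?_
  filter_upwards [hV.ae_dissipation hφ hE hs,
    ae_restrict_of_ae_restrict_of_subset (hE.Icc_subset le_rfl hs) hw] with r ⟨hderiv, hle⟩ hwr
  refine ⟨hderiv, hle.trans ?_⟩
  have hsq : γ ^ 2 * ‖w r j‖ ^ 2 ≤ γ ^ 2 * μ ^ 2 := by gcongr
  have hcancel : 2 * lam * (γ ^ 2 / (2 * lam) * μ ^ 2) = γ ^ 2 * μ ^ 2 := by field_simp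
  linarith [sq_nonneg ‖h (φ r j)‖]

theorem exists_infDist_le (hV : IsStorageFunction Sys 𝒜 h lam γ V)
    (hSys : Sys.HasInvariantFlowSet) (hdwell : Sys.HasDwellTime T) (hlam : 0 < lam) (hT : 0 < T) :
    ∃ κ > 0, ∃ D > 0, ∀ E φ w η, IsSolutionPair Sys E φ w η → ∀ μ : ℝ, 0 ≤ μ →
      (∀ j, ∀ᵐ s ∂(volume.restrict (timeSlice E j)), ‖w s j‖ ≤ μ) →
      (∀ s j, (s, j) ∈ jumpPoints E → ‖η s j‖ ≤ μ) → ∀ s j, (s, j) ∈ E →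
      Metric.infDist (φ s j) 𝒜 ≤
        κ * Real.exp (-lam * s) * Metric.infDist (φ 0 0) 𝒜 + D * μ := by
  obtain ⟨m, hm, hlower⟩ := hV.lower
  obtain ⟨M, hM, hupper⟩ := hV.upper
  obtain ⟨p, hp, hjump⟩ := hV.jump
  set D := γ ^ 2 / (2 * lam) + p / (1 - Real.exp (-(2 * lam) * T)) with hD
  have hD_nonneg : 0 ≤ D := by
    have hexp : Real.exp (-(2 * lam) * T) ≤ 1 := Real.exp_le_one_iff.2 (by nlinarith)
    have := div_nonneg hp (sub_nonneg.2 hexp)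
    positivity
  refine ⟨√(M / m), by positivity, √(D / m) + 1, by positivity,
    fun E φ w η hφ μ hμ hw hη s j hs => ?_⟩
  obtain ⟨t, hE⟩ := hφ.timeDomain.exists_hasJumpTimes
  have hdecay : V (φ s j) ≤ Real.exp (-(2 * lam) * s) * V (φ 0 0) + D * μ ^ 2 := by
    have hbound := hE.le_exp_mul_add_of_dwell (V := fun s j => V (φ s j)) (p := p * μ ^ 2)
      (by positivity) hT (by positivity) (hdwell E φ w η t hφ hE)
      (fun s j hs => hV.le_exp_mul_add_of_flow hlam.ne' hφ hE (hw j) hs)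
      (fun s j hs => (hjump _ (hφ.jumps s j hs).1 _ _ (hφ.jumps s j hs).2).trans
        (by gcongr; exact hη s j hs)) hs
    have hpos : 0 ≤ Real.exp (-(2 * lam) * s) * (γ ^ 2 / (2 * lam) * μ ^ 2) := by positivity
    rw [hD, add_mul, div_mul_eq_mul_div p]
    linarith
  have hsq : Real.exp (-(2 * lam) * s) = Real.exp (-lam * s) ^ 2 := by
    rw [← Real.exp_nat_mul]; ring_nf
  have hdist : m * Metric.infDist (φ s j) 𝒜 ^ 2 ≤
      M * (Real.exp (-lam * s) * Metric.infDist (φ 0 0) 𝒜) ^ 2 + D * μ ^ 2 := by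
    have hinit := mul_le_mul_of_nonneg_left (hupper _ (hφ.mem_flowSet hSys hE.origin))
      (sq_nonneg (Real.exp (-lam * s)))
    rw [hsq] at hdecay
    linarith [hlower _ (hφ.mem_flowSet hSys hs)]
  have hroot := le_sqrt_mul_add_sqrt_mul_of_mul_sq_le hm hM.le hD_nonneg
    (mul_nonneg (Real.exp_pos _).le Metric.infDist_nonneg) hμ hdist
  linarith

theorem exists_infDist_le_of_zeroOn (hV : IsStorageFunction Sys 𝒜 h lam γ V)
    (hSys : Sys.HasInvariantFlowSet) (hdwell : Sys.HasDwellTime T) (hlam : 0 < lam) (hT : 0 < T) :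
    ∃ κ > 0, ∃ rate > 0, ∀ E φ w η, IsSolutionPair Sys E φ w η → ZeroOn E w → ZeroOn E η →
      ∀ s j, (s, j) ∈ E →
        Metric.infDist (φ s j) 𝒜 ≤ κ * Real.exp (-lam * s) * Metric.infDist (φ 0 0) 𝒜 ∧
        Metric.infDist (φ s j) 𝒜 ≤
          κ * Real.exp (-rate * (s + j)) * Metric.infDist (φ 0 0) 𝒜 := by
  obtain ⟨κ, hκ, D, -, hbound⟩ := hV.exists_infDist_le hSys hdwell hlam hT
  have hr : 0 < lam * T / (1 + T) := by positivity
  refine ⟨κ * Real.exp (lam * T / (1 + T)), by positivity, lam * T / (1 + T), hr,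
    fun E φ w η hφ hw hη s j hs => ?_⟩
  obtain ⟨t, hE⟩ := hφ.timeDomain.exists_hasJumpTimes
  have hdist := hbound E φ w η hφ 0 le_rfl
    (fun i => by
      filter_upwards [ae_restrict_mem (hE.ordConnected i).measurableSet] with r hr
      rw [hw r i hr, norm_zero])
    (fun r i hr => by rw [hη r i hr.1, norm_zero]) s j hs
  rw [mul_zero, add_zero] at hdist
  refine ⟨hdist.trans (mul_le_mul_of_nonneg_right ?_ Metric.infDist_nonneg),
    hdist.trans (mul_le_mul_of_nonneg_right ?_ Metric.infDist_nonneg)⟩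
  · have := le_mul_of_one_le_right hκ.le (Real.one_le_exp hr.le)
    gcongr
  · rw [mul_assoc κ]
    gcongr
    exact hdwell.exp_neg_mul_le hT hlam.le hφ hs

theorem exists_infDist_le_max (hV : IsStorageFunction Sys 𝒜 h lam γ V)
    (hSys : Sys.HasInvariantFlowSet) (hdwell : Sys.HasDwellTime T) (hlam : 0 < lam) (hT : 0 < T) :
    ∃ κ > 0, ∃ rate > 0, ∃ ρ : ℝ → ℝ, IsClassK ρ ∧
      ∀ E φ w η, IsSolutionPair Sys E φ w η → linfNorm E (pairInput w η) < ∞ →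
        ∀ s j, (s, j) ∈ E →
          Metric.infDist (φ s j) 𝒜 ≤
            max (κ * Real.exp (-rate * (s + j)) * Metric.infDist (φ 0 0) 𝒜)
              (ρ (linfNorm E (pairInput w η)).toReal) := by
  obtain ⟨κ, hκ, D, hD, hbound⟩ := hV.exists_infDist_le hSys hdwell hlam hT
  refine ⟨2 * (κ * Real.exp (lam * T / (1 + T))), by positivity, lam * T / (1 + T), by positivity,
    fun r => 2 * (D * r), ⟨by fun_prop, fun a _ b _ hab => by dsimp only; gcongr, by simp⟩,
    fun E φ w η hφ hu s j hs => ?_⟩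
  obtain ⟨t, hE⟩ := hφ.timeDomain.exists_hasJumpTimes
  have hdist := hbound E φ w η hφ _ ENNReal.toReal_nonneg
    (fun i => (ae_norm_le_linfNorm hE hu i).mono fun r hr =>
      (norm_le_norm_pairInput_left w η r i).trans hr)
    (fun r i hr => (norm_le_norm_pairInput_right w η r i).trans (norm_le_linfNorm hu hr)) s j hs
  have hexp := mul_le_mul_of_nonneg_right (mul_le_mul_of_nonneg_left
    (hdwell.exp_neg_mul_le hT hlam.le hφ hs) hκ.le) (Metric.infDist_nonneg (x := φ 0 0) (s := 𝒜))
  rcases le_total (κ * Real.exp (-lam * s) * Metric.infDist (φ 0 0) 𝒜)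
    (D * (linfNorm E (pairInput w η)).toReal) with hle | hle
  · exact le_max_of_le_right (by linarith)
  · exact le_max_of_le_left (by linarith)

/-! ### The `L²` gain -/

theorem add_lintegral_Ioc_le (hV : IsStorageFunction Sys 𝒜 h lam γ V)
    (hSys : Sys.HasInvariantFlowSet) (hh : Continuous h) (hlam : 0 ≤ lam)
    (hφ : IsSolutionPair Sys E φ w η) (hE : HasJumpTimes E t) (hs : (s, j) ∈ E) :
    ENNReal.ofReal (V (φ s j)) + ∫⁻ r in Ioc (t j) s, ‖h (φ r j)‖ₑ ^ (2 : ℝ) ≤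
      ENNReal.ofReal (V (φ (t j) j)) +
        ∫⁻ r in Ioc (t j) s, ENNReal.ofReal (γ ^ 2) * ‖w r j‖ₑ ^ (2 : ℝ) := by
  have hts := hE.le hs
  have hsub := hE.Icc_subset le_rfl hs
  have hV_nonneg : ∀ r, (r, j) ∈ E → 0 ≤ V (φ r j) := fun r hr =>
    hV.nonneg (hφ.mem_flowSet hSys hr)
  have hy : IntegrableOn (fun r => ‖h (φ r j)‖ ^ 2) (Icc (t j) s) := by
    have hcont := (hφ.absolutelyContinuousOnInterval hE hs).continuousOn
    rw [uIcc_of_le hts] at hcont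
    exact ((hh.comp_continuousOn hcont).norm.pow 2).integrableOn_Icc
  have hw : IntegrableOn (fun r => ‖w r j‖ ^ 2) (Icc (t j) s) :=
    hφ.input_w.integrableOn_norm_sq hsub
  have hyI := (intervalIntegrable_iff_integrableOn_Icc_of_le hts).2 hy
  have hwI := ((intervalIntegrable_iff_integrableOn_Icc_of_le hts).2 hw).const_mul (γ ^ 2)
  have hsupply : V (φ s j) - V (φ (t j) j) ≤
      ∫ r in t j..s, (γ ^ 2 * ‖w r j‖ ^ 2 - ‖h (φ r j)‖ ^ 2) := by
    refine sub_le_integral_of_ae_hasDerivAt_le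
      (f' := fun r => fderiv ℝ V (φ r j) (Sys.flow (φ r j) (w r j))) hts
      (hV.absolutelyContinuousOnInterval hφ hE hs) ?_ (hwI.sub hyI)
    filter_upwards [hV.ae_dissipation hφ hE hs, ae_restrict_mem measurableSet_Icc]
      with r ⟨hderiv, hle⟩ hr
    exact ⟨hderiv, by linarith [mul_nonneg hlam (hV_nonneg r (hsub hr))]⟩
  rw [intervalIntegral.integral_sub hwI hyI, intervalIntegral.integral_const_mul,
    intervalIntegral.integral_of_le hts, intervalIntegral.integral_of_le hts] at hsupply
  rw [lintegral_const_mul' _ _ ENNReal.ofReal_ne_top,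
    lintegral_enorm_sq_eq_ofReal_integral (hy.mono_set Ioc_subset_Icc_self),
    lintegral_enorm_sq_eq_ofReal_integral (hw.mono_set Ioc_subset_Icc_self),
    ← ENNReal.ofReal_mul (sq_nonneg γ),
    ← ENNReal.ofReal_add (hV_nonneg _ hs) (integral_nonneg fun _ => sq_nonneg _),
    ← ENNReal.ofReal_add (hV_nonneg _ (hE.start_mem hs))
      (mul_nonneg (sq_nonneg γ) (integral_nonneg fun _ => sq_nonneg _))]
  exact ENNReal.ofReal_le_ofReal (by linarith)

theorem lintegral_firstCounter_le (hV : IsStorageFunction Sys 𝒜 h lam γ V)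
    (hSys : Sys.HasInvariantFlowSet) (hh : Continuous h) (hlam : 0 ≤ lam)
    (hφ : IsSolutionPair Sys E φ w η) (hη : ZeroOn E η) (hE : HasJumpTimes E t)
    (hs : s ∈ ordinaryTimes E) :
    ∫⁻ r in Ioc 0 s, ‖h (φ r (firstCounter E r))‖ₑ ^ (2 : ℝ) ≤ ENNReal.ofReal (V (φ 0 0)) +
      ENNReal.ofReal (γ ^ 2) * ∫⁻ r in Ioc 0 s, ‖w r (firstCounter E r)‖ₑ ^ (2 : ℝ) := by
  obtain ⟨p, -, hjump⟩ := hV.jump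
  obtain ⟨j, hj⟩ := hs
  rw [← lintegral_const_mul' _ _ ENNReal.ofReal_ne_top]
  refine le_add_self.trans (hE.add_lintegral_firstCounter_le
    (V := fun s j => ENNReal.ofReal (V (φ s j))) (f := fun r j => ‖h (φ r j)‖ₑ ^ (2 : ℝ))
    (g := fun r j => ENNReal.ofReal (γ ^ 2) * ‖w r j‖ₑ ^ (2 : ℝ))
    (fun s j hs => hV.add_lintegral_Ioc_le hSys hh hlam hφ hE hs)
    (fun s j hs => ENNReal.ofReal_le_ofReal ?_) hj)
  simpa [hη s j hs.1] using hjump _ (hφ.jumps s j hs).1 _ _ (hφ.jumps s j hs).2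

theorem hasL2Gain (hV : IsStorageFunction Sys 𝒜 h lam γ V)
    (hSys : Sys.HasInvariantFlowSet) (hh : Continuous h) (hlam : 0 ≤ lam) (hγ : 0 ≤ γ) :
    HasL2Gain Sys 𝒜 h γ := by
  obtain ⟨M, hM, hupper⟩ := hV.upper
  refine ⟨√M, by positivity, fun E φ w η hφ hη => ?_⟩
  obtain ⟨t, hE⟩ := hφ.timeDomain.exists_hasJumpTimes
  rw [hE.l2Norm_eq_iSup, hE.l2Norm_eq_iSup]
  set I := ⨆ s ∈ ordinaryTimes E, ∫⁻ r in Ioc 0 s, ‖w r (firstCounter E r)‖ₑ ^ (2 : ℝ)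
  have hinit : V (φ 0 0) ≤ (√M * Metric.infDist (φ 0 0) 𝒜) ^ 2 := by
    rw [mul_pow, Real.sq_sqrt hM.le]
    exact hupper _ (hφ.mem_flowSet hSys hE.origin)
  have hsq : ⨆ s ∈ ordinaryTimes E, ∫⁻ r in Ioc 0 s, ‖h (φ r (firstCounter E r))‖ₑ ^ (2 : ℝ) ≤
      ENNReal.ofReal ((√M * Metric.infDist (φ 0 0) 𝒜) ^ 2) + ENNReal.ofReal (γ ^ 2) * I := by
    refine iSup₂_le fun s hs => (hV.lintegral_firstCounter_le hSys hh hlam hφ hη hE hs).trans ?_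
    gcongr
    exact le_iSup₂ (f := fun s (_ : s ∈ ordinaryTimes E) =>
      ∫⁻ r in Ioc 0 s, ‖w r (firstCounter E r)‖ₑ ^ (2 : ℝ)) s hs
  have hsqrt : ∀ {a : ℝ}, 0 ≤ a → ENNReal.ofReal (a ^ 2) ^ (1 / 2 : ℝ) = ENNReal.ofReal a :=
    fun ha => by
      rw [ENNReal.ofReal_rpow_of_nonneg (sq_nonneg _) (by norm_num), ← Real.sqrt_eq_rpow,
        Real.sqrt_sq ha]
  calc _ ≤ _ := ENNReal.rpow_le_rpow hsq (by norm_num)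
    _ ≤ _ := ENNReal.rpow_add_le_add_rpow _ _ (by norm_num) (by norm_num)
    _ = _ := by
      rw [ENNReal.mul_rpow_of_nonneg _ _ (by norm_num), hsqrt hγ,
        hsqrt (mul_nonneg (Real.sqrt_nonneg _) Metric.infDist_nonneg)]

end IsStorageFunction

/-! ## Extension of solution pairs -/

/-- The signal `u`, extended by zero outside `E`. -/
noncomputable def cutoff {V : Type*} [Zero V] (E : Set (ℝ × ℕ)) (u : ℝ → ℕ → V) : ℝ → ℕ → V :=
  fun s j => E.indicator (fun p => u p.1 p.2) (s, j)

/-- The signal `u` is essentially bounded on each interval of flow of `E`, uniformly up to its open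
end. -/
def IsSliceBounded {V : Type*} [NormedAddCommGroup V] (E : Set (ℝ × ℕ)) (u : ℝ → ℕ → V) : Prop :=
  ∀ j, ∃ M : ℝ, ∀ᵐ s ∂(volume.restrict (timeSlice E j)), ‖u s j‖ ≤ M

section Cutoff

variable {V : Type*} [NormedAddCommGroup V] {E : Set (ℝ × ℕ)} {u : ℝ → ℕ → V} {s : ℝ} {j : ℕ}

theorem cutoff_of_mem (u : ℝ → ℕ → V) (h : (s, j) ∈ E) : cutoff E u s j = u s j :=
  indicator_of_mem h _

theorem cutoff_of_notMem (u : ℝ → ℕ → V) (h : (s, j) ∉ E) : cutoff E u s j = 0 :=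
  indicator_of_notMem h _

theorem cutoff_zero (E : Set (ℝ × ℕ)) : cutoff E (0 : ℝ → ℕ → V) = 0 := by
  ext s j
  exact congrFun (indicator_zero V E) (s, j)

theorem isSliceBounded_zero (E : Set (ℝ × ℕ)) : IsSliceBounded E (0 : ℝ → ℕ → V) :=
  fun _ => ⟨0, by simp⟩

theorem IsHybridInput.cutoff {t : ℕ → ℝ} (hu : IsHybridInput E u) (hE : HasJumpTimes E t)
    (hbdd : IsSliceBounded E u) (E' : Set (ℝ × ℕ)) : IsHybridInput E' (cutoff E u) := by
  intro j
  have hmeas : MeasurableSet (timeSlice E j) := (hE.ordConnected j).measurableSet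
  have hind : (fun s => _root_.cutoff E u s j) = (timeSlice E j).indicator fun s => u s j := rfl
  refine ⟨?_, fun K _ _ => ?_⟩
  · rw [hind]
    exact ((aestronglyMeasurable_indicator_iff hmeas).2 (hu j).1).restrict
  · obtain ⟨M, hM⟩ := hbdd j
    refine ⟨max M 0, ae_restrict_of_ae ?_⟩
    filter_upwards [(ae_restrict_iff' hmeas).1 hM] with s hs
    by_cases hsE : (s, j) ∈ E
    · rw [cutoff_of_mem u hsE]
      exact (hs hsE).trans (le_max_left _ _)
    · rw [cutoff_of_notMem u hsE, norm_zero]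
      exact le_max_right _ _

end Cutoff

theorem isSliceBounded_of_linfNorm_lt_top {W Y : Type*} [NormedAddCommGroup W]
    [NormedAddCommGroup Y] {E : Set (ℝ × ℕ)} {w : ℝ → ℕ → W} {η : ℝ → ℕ → Y} {t : ℕ → ℝ}
    (hE : HasJumpTimes E t) (hu : linfNorm E (pairInput w η) < ∞) :
    IsSliceBounded E w ∧ IsSliceBounded E η :=
  ⟨fun j => ⟨_, (ae_norm_le_linfNorm hE hu j).mono fun s hs =>
      (norm_le_norm_pairInput_left w η s j).trans hs⟩,
    fun j => ⟨_, (ae_norm_le_linfNorm hE hu j).mono fun s hs =>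
      (norm_le_norm_pairInput_right w η s j).trans hs⟩⟩

/-- The domain `E` with its `k`-th interval of flow replaced by `I`. -/
def replaceSlice (E : Set (ℝ × ℕ)) (k : ℕ) (I : Set ℝ) : Set (ℝ × ℕ) :=
  {p | p.1 ∈ Function.update (timeSlice E) k I p.2}

section ReplaceSlice

variable {E : Set (ℝ × ℕ)} {t : ℕ → ℝ} {J j k : ℕ} {I : Set ℝ}

theorem timeSlice_replaceSlice_self (E : Set (ℝ × ℕ)) (k : ℕ) (I : Set ℝ) :
    timeSlice (replaceSlice E k I) k = I := by
  change Function.update (timeSlice E) k I k = I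
  exact Function.update_self ..

theorem timeSlice_replaceSlice_of_ne (h : j ≠ k) :
    timeSlice (replaceSlice E k I) j = timeSlice E j := by
  change Function.update (timeSlice E) k I j = timeSlice E j
  exact Function.update_of_ne h ..

theorem subset_replaceSlice (h : timeSlice E k ⊆ I) : E ⊆ replaceSlice E k I := by
  rintro ⟨s, j⟩ hs
  change s ∈ timeSlice (replaceSlice E k I) j
  rcases eq_or_ne j k with rfl | hj
  · rw [timeSlice_replaceSlice_self]
    exact h hs
  · rwa [timeSlice_replaceSlice_of_ne hj]

theorem update_eq_of_mem {X : Type*} {φ : ℝ → ℕ → X} {f : ℝ → X}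
    (hfφ : ∀ s ∈ timeSlice E k, f s = φ s k) {s : ℝ} (hs : (s, j) ∈ E) :
    Function.update (φ s) k (f s) j = φ s j := by
  rcases eq_or_ne j k with rfl | hj
  · rw [Function.update_self, hfφ s hs]
  · rw [Function.update_of_ne hj]

theorem IsFiniteDomain.isHybridTimeDomain_replaceSlice_succ (h : IsFiniteDomain E t J)
    (hJ : timeSlice E J = Icc (t J) (t (J + 1))) :
    IsHybridTimeDomain (replaceSlice E (J + 1) (Icc (t (J + 1)) (t (J + 1)))) := by
  refine ⟨fun j => t (min j (J + 1)), by simpa using h.zero, fun a b hab => h.mono (by omega),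
    Or.inr ⟨J + 1, fun j hj => ?_, Or.inl ?_, fun j hj => ?_⟩⟩
  · beta_reduce
    rw [timeSlice_replaceSlice_of_ne hj.ne, min_eq_left hj.le, min_eq_left (Nat.succ_le_of_lt hj)]
    rcases (Nat.lt_succ_iff.1 hj).eq_or_lt with rfl | hj'
    · exact hJ
    · exact h.slice j hj'
  · beta_reduce
    rw [timeSlice_replaceSlice_self, min_self, min_eq_right (Nat.le_succ _)]
  · rw [timeSlice_replaceSlice_of_ne hj.ne']
    exact h.empty j (by omega)

theorem IsFiniteDomain.isHybridTimeDomain_replaceSlice_last (h : IsFiniteDomain E t J) {b : ℝ}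
    (hb : t J ≤ b) : IsHybridTimeDomain (replaceSlice E J (Icc (t J) b)) := by
  refine ⟨fun j => if j ≤ J then t j else b, by simpa using h.zero, fun i j hij => ?_,
    Or.inr ⟨J, fun j hj => ?_, Or.inl ?_, fun j hj => ?_⟩⟩
  · dsimp only
    split_ifs with hi hj
    · exact h.mono hij
    · exact (h.mono hi).trans hb
    · omega
    · exact le_rfl
  · beta_reduce
    rw [timeSlice_replaceSlice_of_ne hj.ne, if_pos hj.le, if_pos (Nat.succ_le_of_lt hj)]
    exact h.slice j hj
  · beta_reduce
    rw [timeSlice_replaceSlice_self, if_pos le_rfl, if_neg (Nat.not_succ_le_self J)]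
  · rw [timeSlice_replaceSlice_of_ne hj.ne']
    exact h.empty j hj

theorem IsFiniteDomain.eq_of_mem_jumpPoints_replaceSlice_succ (h : IsFiniteDomain E t J) {T s : ℝ}
    (hs : (s, j) ∈ jumpPoints (replaceSlice E (J + 1) (Icc T T))) (hsE : (s, j) ∉ jumpPoints E) :
    s = T ∧ j = J := by
  obtain ⟨hj, hj'⟩ : s ∈ timeSlice (replaceSlice E (J + 1) (Icc T T)) j ∧
    s ∈ timeSlice (replaceSlice E (J + 1) (Icc T T)) (j + 1) := hs
  have hne : j ≠ J + 1 := by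
    rintro rfl
    rw [timeSlice_replaceSlice_of_ne (Nat.succ_ne_self _), h.empty _ (by omega)] at hj'
    exact hj'
  rw [timeSlice_replaceSlice_of_ne hne] at hj
  rcases eq_or_ne j J with rfl | hjJ
  · rw [timeSlice_replaceSlice_self, Icc_self] at hj'
    exact ⟨hj', rfl⟩
  · rw [timeSlice_replaceSlice_of_ne (by omega)] at hj'
    exact absurd ⟨hj, hj'⟩ hsE

theorem IsFiniteDomain.jumpPoints_replaceSlice_last_subset (h : IsFiniteDomain E t J)
    (hJ : t J ∈ timeSlice E J) (b : ℝ) :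
    jumpPoints (replaceSlice E J (Icc (t J) b)) ⊆ jumpPoints E := by
  rintro ⟨s, j⟩ hs
  obtain ⟨hj, hj'⟩ : s ∈ timeSlice (replaceSlice E J (Icc (t J) b)) j ∧
    s ∈ timeSlice (replaceSlice E J (Icc (t J) b)) (j + 1) := hs
  have hlt : j < J := by
    by_contra! hle
    rw [timeSlice_replaceSlice_of_ne (by omega), h.empty _ (by omega)] at hj'
    exact hj'
  rw [timeSlice_replaceSlice_of_ne hlt.ne] at hj
  refine ⟨hj, ?_⟩
  rcases eq_or_ne (j + 1) J with rfl | hne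
  · rw [timeSlice_replaceSlice_self] at hj'
    rw [h.slice j hlt] at hj
    rwa [← le_antisymm hj.2 hj'.1] at hJ
  · rwa [timeSlice_replaceSlice_of_ne hne] at hj'

end ReplaceSlice

section Glue

variable {X : Type*} [NormedAddCommGroup X] {f g : ℝ → X} {a b T : ℝ}

theorem absolutelyContinuousOnInterval_ite (haT : a ≤ T) (hTb : T ≤ b)
    (hf : AbsolutelyContinuousOnInterval f a T) (hg : AbsolutelyContinuousOnInterval g T b)
    (hfg : f T = g T) :
    AbsolutelyContinuousOnInterval (fun s => if s ≤ T then f s else g s) a b := by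
  refine absolutelyContinuousOnInterval_trans haT hTb
    (absolutelyContinuousOnInterval_congr (fun s hs => ?_) hf)
    (absolutelyContinuousOnInterval_congr (fun s hs => ?_) hg)
  · rw [uIcc_of_le haT] at hs
    exact (if_pos hs.2).symm
  · rw [uIcc_of_le hTb] at hs
    rcases hs.1.eq_or_lt with rfl | hlt
    · rw [if_pos le_rfl, hfg]
    · rw [if_neg hlt.not_ge]

theorem ae_hasDerivAt_ite [NormedSpace ℝ X] {C : Set X} {F : ℝ → X → X}
    (hf : ∀ᵐ s ∂(volume.restrict (Icc a T)), f s ∈ C ∧ HasDerivAt f (F s (f s)) s)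
    (hg : ∀ s ∈ Ioo T b, g s ∈ C ∧ HasDerivAt g (F s (g s)) s) :
    ∀ᵐ s ∂(volume.restrict (Icc a b)), (if s ≤ T then f s else g s) ∈ C ∧
      HasDerivAt (fun s => if s ≤ T then f s else g s) (F s (if s ≤ T then f s else g s)) s := by
  have hne : ∀ c : ℝ, ∀ᵐ s : ℝ, s ≠ c := fun c => by simp [ae_iff, measure_singleton]
  rw [ae_restrict_iff' measurableSet_Icc] at hf ⊢
  filter_upwards [hf, hne T, hne b] with s hs hsT hsb hsI
  rcases lt_or_gt_of_ne hsT with hlt | hgt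
  · rw [if_pos hlt.le]
    refine (hs ⟨hsI.1, hlt.le⟩).imp_right fun h => h.congr_of_eventuallyEq ?_
    filter_upwards [Iio_mem_nhds hlt] with x hx using if_pos (le_of_lt hx)
  · rw [if_neg hgt.not_ge]
    refine (hg s ⟨hgt, lt_of_le_of_ne hsI.2 hsb⟩).imp_right fun h => h.congr_of_eventuallyEq ?_
    filter_upwards [Ioi_mem_nhds hgt] with x hx using if_neg (not_le.2 hx)

end Glue

/-- The solution pair extends to a strictly larger domain, with zero disturbances on the part that
is added. -/
def IsExtendable {X W Y : Type*} [NormedAddCommGroup X] [NormedSpace ℝ X] [NormedAddCommGroup W]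
    [NormedAddCommGroup Y] (Sys : HybridSystem X W Y) (E : Set (ℝ × ℕ)) (φ : ℝ → ℕ → X)
    (w : ℝ → ℕ → W) (η : ℝ → ℕ → Y) : Prop :=
  ∃ E' φ', IsSolutionPair Sys E' φ' (cutoff E w) (cutoff E η) ∧ E ⊂ E' ∧
    ∀ s j, (s, j) ∈ E → φ' s j = φ s j

/-- Without disturbances, the system can always move on from a state in the flow set, by a jump or
by flowing inside the flow set for a short time. -/
def HybridSystem.IsViable {X W Y : Type*} [NormedAddCommGroup X] [NormedSpace ℝ X] [Zero W]
    (Sys : HybridSystem X W Y) : Prop :=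
  ∀ x ∈ Sys.flowSet, (x ∈ Sys.jumpSet ∧ ∀ η, (Sys.jump x η).Nonempty) ∨
    ∃ h > 0, ∀ T, ∃ α : ℝ → X, α T = x ∧ AbsolutelyContinuousOnInterval α T (T + h) ∧
      ∀ s ∈ Ioo T (T + h), α s ∈ Sys.flowSet ∧ HasDerivAt α (Sys.flow (α s) 0) s

/-- Affine growth of the flow map, which excludes finite escape times. -/
def HybridSystem.HasLinearGrowth {X W Y : Type*} [NormedAddCommGroup X] [NormedAddCommGroup W]
    (Sys : HybridSystem X W Y) : Prop :=
  ∃ k, 0 ≤ k ∧ ∀ x w, ‖Sys.flow x w‖ ≤ k * (1 + ‖x‖ + ‖w‖)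

namespace IsSolutionPair

section NormedSpace

variable {X W Y : Type*} [NormedAddCommGroup X] [NormedSpace ℝ X] [NormedAddCommGroup W]
  [NormedAddCommGroup Y] {Sys : HybridSystem X W Y} {E : Set (ℝ × ℕ)} {φ : ℝ → ℕ → X}
  {w : ℝ → ℕ → W} {η : ℝ → ℕ → Y} {t : ℕ → ℝ} {f : ℝ → X} {a b : ℝ} {J k : ℕ}

theorem replaceSlice (h : IsSolutionPair Sys E φ w η)
    (hw : IsSliceBounded E w) (hη : IsSliceBounded E η)
    (hdom : IsHybridTimeDomain (_root_.replaceSlice E k (Icc a b)))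
    (hfφ : ∀ s ∈ timeSlice E k, f s = φ s k)
    (hf : AbsolutelyContinuousOnInterval f a b)
    (hflow : ∀ᵐ s ∂(volume.restrict (Icc a b)), f s ∈ Sys.flowSet ∧
      HasDerivAt f (Sys.flow (f s) (cutoff E w s k)) s)
    (hjump : ∀ s j, (s, j) ∈ jumpPoints (_root_.replaceSlice E k (Icc a b)) →
      (s, j) ∉ jumpPoints E → j + 1 = k ∧ (s, j) ∈ E ∧ φ s j ∈ Sys.jumpSet ∧
        f s ∈ Sys.jump (φ s j) (η s j)) :
    IsSolutionPair Sys (_root_.replaceSlice E k (Icc a b)) (fun s => Function.update (φ s) k (f s))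
      (cutoff E w) (cutoff E η) := by
  obtain ⟨t, hE⟩ := h.timeDomain.exists_hasJumpTimes
  refine ⟨hdom, fun j r hr s hs => ?_, h.input_w.cutoff hE hw _, h.input_η.cutoff hE hη _, ?_,
    fun j => ?_, fun s j hs => ?_⟩
  · rcases eq_or_ne j k with rfl | hj
    · rw [timeSlice_replaceSlice_self] at hr hs
      simp only [Function.update_self]
      exact hf.mono ((uIcc_subset_Icc hr hs).trans Icc_subset_uIcc)
    · rw [timeSlice_replaceSlice_of_ne hj] at hr hs
      simp only [Function.update_of_ne hj]
      exact h.arc j r hr s hs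
  · rw [update_eq_of_mem hfφ hE.origin]
    exact h.initial
  · rcases eq_or_ne j k with rfl | hj
    · simpa only [timeSlice_replaceSlice_self, Function.update_self] using hflow
    · simp only [timeSlice_replaceSlice_of_ne hj, Function.update_of_ne hj]
      filter_upwards [h.flows j, ae_restrict_mem (hE.ordConnected j).measurableSet] with s hs hsE
      rwa [cutoff_of_mem w (show (s, j) ∈ E from hsE)]
  · by_cases hsE : (s, j) ∈ jumpPoints E
    · rw [update_eq_of_mem hfφ hsE.1, update_eq_of_mem hfφ hsE.2, cutoff_of_mem η hsE.1]
      exact h.jumps s j hsE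
    · obtain ⟨rfl, hmem, hjump⟩ := hjump s j hs hsE
      rwa [update_eq_of_mem hfφ hmem, Function.update_self, cutoff_of_mem η hmem]

theorem isExtendable_of_jump (h : IsSolutionPair Sys E φ w η) (hE : IsFiniteDomain E t J)
    (hw : IsSliceBounded E w) (hη : IsSliceBounded E η)
    (hJ : timeSlice E J = Icc (t J) (t (J + 1))) (hjump : φ (t (J + 1)) J ∈ Sys.jumpSet)
    {g : X} (hg : g ∈ Sys.jump (φ (t (J + 1)) J) (η (t (J + 1)) J)) : IsExtendable Sys E φ w η := by
  have hempty : timeSlice E (J + 1) = ∅ := hE.empty _ (Nat.lt_succ_self J)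
  have hfφ : ∀ s ∈ timeSlice E (J + 1), g = φ s (J + 1) := by simp [hempty]
  have hend : t (J + 1) ∈ timeSlice E J := hJ ▸ right_mem_Icc.2 (hE.mono (Nat.le_succ J))
  refine ⟨_, _, h.replaceSlice hw hη (hE.isHybridTimeDomain_replaceSlice_succ hJ) hfφ
    (absolutelyContinuousOnInterval_const g) (by simp) fun s j hs hsE => ?_,
    ⟨subset_replaceSlice (by simp [hempty]), fun hsub => ?_⟩, fun s j hs => update_eq_of_mem hfφ hs⟩
  · obtain ⟨rfl, rfl⟩ := hE.eq_of_mem_jumpPoints_replaceSlice_succ hs hsE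
    exact ⟨rfl, hend, hjump, hg⟩
  · have hmem : (t (J + 1), J + 1) ∈ _root_.replaceSlice E (J + 1) (Icc (t (J + 1)) (t (J + 1))) :=
      (timeSlice_replaceSlice_self E _ _).ge (left_mem_Icc.2 le_rfl)
    exact hempty.le (hsub hmem)

theorem isExtendable_of_flow (h : IsSolutionPair Sys E φ w η) (hE : IsFiniteDomain E t J)
    (hw : IsSliceBounded E w) (hη : IsSliceBounded E η) (hstart : t J ∈ timeSlice E J)
    (hsub : timeSlice E J ⊆ Icc (t J) b) (hb : b ∉ timeSlice E J)
    (hfφ : ∀ s ∈ timeSlice E J, f s = φ s J) (hf : AbsolutelyContinuousOnInterval f (t J) b)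
    (hflow : ∀ᵐ s ∂(volume.restrict (Icc (t J) b)), f s ∈ Sys.flowSet ∧
      HasDerivAt f (Sys.flow (f s) (cutoff E w s J)) s) : IsExtendable Sys E φ w η := by
  have htb : t J ≤ b := (hsub hstart).2
  refine ⟨_, _, h.replaceSlice hw hη (hE.isHybridTimeDomain_replaceSlice_last htb) hfφ hf hflow
    fun s j hs hsE => absurd (hE.jumpPoints_replaceSlice_last_subset hstart b hs) hsE,
    ⟨subset_replaceSlice hsub, fun hsub' => hb ?_⟩, fun s j hs => update_eq_of_mem hfφ hs⟩
  have hmem : (b, J) ∈ _root_.replaceSlice E J (Icc (t J) b) :=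
    (timeSlice_replaceSlice_self E J _).ge (right_mem_Icc.2 htb)
  exact hsub' hmem

theorem isExtendable_of_Icc (h : IsSolutionPair Sys E φ w η) (hSys : Sys.HasInvariantFlowSet)
    (hviable : Sys.IsViable) (hE : IsFiniteDomain E t J) (hw : IsSliceBounded E w)
    (hη : IsSliceBounded E η) (hJ : timeSlice E J = Icc (t J) (t (J + 1))) :
    IsExtendable Sys E φ w η := by
  set T := t (J + 1)
  have htT : t J ≤ T := hE.mono (Nat.le_succ J)
  have hend : T ∈ timeSlice E J := hJ ▸ right_mem_Icc.2 htT
  have hstart : t J ∈ timeSlice E J := hJ ▸ left_mem_Icc.2 htT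
  rcases hviable _ (h.mem_flowSet hSys hend) with ⟨hjump, hne⟩ | ⟨d, hd, hα⟩
  · exact h.isExtendable_of_jump hE hw hη hJ hjump (hne _).some_mem
  obtain ⟨α, hαT, hαc, hαflow⟩ := hα T
  have hcut : ∀ s, s ∈ Icc (t J) T → cutoff E w s J = w s J := fun s hs =>
    cutoff_of_mem w (hJ.ge hs)
  have hcut' : ∀ s, T < s → cutoff E w s J = 0 := fun s hs =>
    cutoff_of_notMem w fun hsE => hs.not_ge (hJ.le hsE).2
  refine h.isExtendable_of_flow hE hw hη hstart
    (hJ.trans_subset (Icc_subset_Icc_right (le_add_of_nonneg_right hd.le)))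
    (fun hmem => by linarith [(hJ.le hmem).2]) (fun s hs => if_pos (hJ.le hs).2)
    (absolutelyContinuousOnInterval_ite htT (by linarith) (h.arc J _ hstart _ hend) hαc hαT.symm)
    (ae_hasDerivAt_ite (F := fun s x => Sys.flow x (cutoff E w s J)) ?_ fun s hs => ?_)
  · have hae := h.flows J
    rw [hJ] at hae
    filter_upwards [hae, ae_restrict_mem measurableSet_Icc] with s hs hsI
    rwa [hcut s hsI]
  · rw [hcut' s hs.1]
    exact hαflow s hs

end NormedSpace

section InnerProductSpace

variable {X W Y : Type*} [NormedAddCommGroup X] [InnerProductSpace ℝ X] [NormedAddCommGroup W]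
  [NormedAddCommGroup Y] {Sys : HybridSystem X W Y} {E : Set (ℝ × ℕ)} {φ : ℝ → ℕ → X}
  {w : ℝ → ℕ → W} {η : ℝ → ℕ → Y} {t : ℕ → ℝ} {a b : ℝ} {J : ℕ}

theorem exists_lipschitzOnWith_of_Ico (h : IsSolutionPair Sys E φ w η)
    (hgrowth : Sys.HasLinearGrowth) (hw : IsSliceBounded E w) (hJ : timeSlice E J = Ico a b) :
    ∃ K, LipschitzOnWith K (fun s => φ s J) (Ico a b) := by
  obtain ⟨M, hM⟩ := hw J
  obtain ⟨k, hk, hflow⟩ := hgrowth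
  have hae := h.flows J
  rw [hJ] at hae hM
  refine exists_lipschitzOnWith_of_ae_linear_growth
    (f' := fun s => Sys.flow (φ s J) (w s J)) (k := k * (1 + |M|)) (by positivity)
    (fun r hr s hs => h.arc J r (hJ ▸ hr) s (hJ ▸ hs)) ?_
  filter_upwards [hae, hM] with s hs hsM
  refine ⟨hs.2, (hflow _ _).trans ?_⟩
  rw [mul_assoc]
  gcongr
  nlinarith [hsM.trans (le_abs_self M), mul_nonneg (abs_nonneg M) (norm_nonneg (φ s J))]

theorem isExtendable_of_Ico [FiniteDimensional ℝ X] (h : IsSolutionPair Sys E φ w η)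
    (hgrowth : Sys.HasLinearGrowth) (hE : IsFiniteDomain E t J) (hw : IsSliceBounded E w)
    (hη : IsSliceBounded E η) (hlt : t J < t (J + 1))
    (hJ : timeSlice E J = Ico (t J) (t (J + 1))) : IsExtendable Sys E φ w η := by
  obtain ⟨K, hK⟩ := h.exists_lipschitzOnWith_of_Ico hgrowth hw hJ
  obtain ⟨g, hg, hφg⟩ := hK.extend_finite_dimension
  refine h.isExtendable_of_flow hE hw hη (hJ ▸ left_mem_Ico.2 hlt)
    (hJ.trans_subset Ico_subset_Icc_self) (hJ ▸ right_notMem_Ico)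
    (fun s hs => (hφg (hJ.le hs)).symm) hg.lipschitzOnWith.absolutelyContinuousOnInterval ?_
  have hflow := h.flows J
  rw [hJ, ← restrict_Ioo_eq_restrict_Ico] at hflow
  rw [← restrict_Ioo_eq_restrict_Icc]
  filter_upwards [hflow, ae_restrict_mem measurableSet_Ioo] with s hs hsI
  have hsE : (s, J) ∈ E := hJ.ge (Ioo_subset_Ico_self hsI)
  rw [cutoff_of_mem w hsE, ← hφg (Ioo_subset_Ico_self hsI)]
  refine hs.imp_right fun hderiv => hderiv.congr_of_eventuallyEq ?_
  filter_upwards [Ioo_mem_nhds hsI.1 hsI.2] with r hr using (hφg (Ioo_subset_Ico_self hr)).symm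

theorem isExtendable [FiniteDimensional ℝ X] (h : IsSolutionPair Sys E φ w η)
    (hSys : Sys.HasInvariantFlowSet) (hviable : Sys.IsViable) (hgrowth : Sys.HasLinearGrowth)
    (hc : ¬ IsCompleteDomain E) (hw : IsSliceBounded E w) (hη : IsSliceBounded E η) :
    IsExtendable Sys E φ w η := by
  obtain ⟨t, J, hE, hJ | ⟨hlt, hJ⟩⟩ := h.timeDomain.exists_isFiniteDomain_of_not_isCompleteDomain hc
  · exact h.isExtendable_of_Icc hSys hviable hE hw hη hJ
  · exact h.isExtendable_of_Ico hgrowth hE hw hη hlt hJ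

end InnerProductSpace

end IsSolutionPair

section Complete

variable {X W Y : Type*} [NormedAddCommGroup X] [InnerProductSpace ℝ X] [FiniteDimensional ℝ X]
  [NormedAddCommGroup W] [NormedAddCommGroup Y] {Sys : HybridSystem X W Y} {E : Set (ℝ × ℕ)}
  {φ : ℝ → ℕ → X} {w : ℝ → ℕ → W} {η : ℝ → ℕ → Y}

theorem IsMaximalPair.isCompleteDomain (h : IsMaximalPair Sys E φ w η)
    (hSys : Sys.HasInvariantFlowSet) (hviable : Sys.IsViable) (hgrowth : Sys.HasLinearGrowth)
    (hu : linfNorm E (pairInput w η) < ∞) : IsCompleteDomain E := by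
  obtain ⟨hsol, hmax⟩ := h
  obtain ⟨t, hE⟩ := hsol.timeDomain.exists_hasJumpTimes
  obtain ⟨hw, hη⟩ := isSliceBounded_of_linfNorm_lt_top hE hu
  by_contra hc
  obtain ⟨E', φ', hsol', hlt, hagree⟩ := hsol.isExtendable hSys hviable hgrowth hc hw hη
  exact hlt.ne (hmax E' φ' _ _ hsol' hlt.subset fun s j hs =>
    ⟨hagree s j hs, cutoff_of_mem w hs, cutoff_of_mem η hs⟩).symm

theorem IsMaximalZeroInput.isCompleteDomain (h : IsMaximalZeroInput Sys E φ)
    (hSys : Sys.HasInvariantFlowSet) (hviable : Sys.IsViable) (hgrowth : Sys.HasLinearGrowth) :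
    IsCompleteDomain E := by
  obtain ⟨hsol, hmax⟩ := h
  by_contra hc
  obtain ⟨E', φ', hsol', hlt, hagree⟩ := hsol.isExtendable hSys hviable hgrowth hc
    (isSliceBounded_zero E) (isSliceBounded_zero E)
  rw [cutoff_zero, cutoff_zero] at hsol'
  exact hlt.ne (hmax E' φ' hsol' hlt.subset hagree).symm

end Complete

/-! ## Quadratic forms -/

section QuadraticForms

variable {m n : Type*} [Fintype m] [Fintype n]

theorem dotProduct_self_eq_norm_sq (v : n → ℝ) :
    v ⬝ᵥ v = ‖(WithLp.toLp 2 v : EuclideanSpace ℝ n)‖ ^ 2 := by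
  rw [EuclideanSpace.real_norm_sq_eq]
  simp only [dotProduct, sq]

theorem dotProduct_self_nonneg (v : n → ℝ) : 0 ≤ v ⬝ᵥ v := by
  rw [dotProduct_self_eq_norm_sq]
  positivity

theorem exists_mulVec_dotProduct_mulVec_le (M : Matrix m n ℝ) :
    ∃ K > 0, ∀ v : n → ℝ, (M *ᵥ v) ⬝ᵥ (M *ᵥ v) ≤ K * (v ⬝ᵥ v) := by
  classical
  let T := LinearMap.toContinuousLinearMap (Matrix.toLpLin 2 2 M)
  refine ⟨‖T‖ ^ 2 + 1, by positivity, fun v => ?_⟩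
  have hT : ‖T (WithLp.toLp 2 v)‖ ^ 2 ≤ (‖T‖ * ‖WithLp.toLp 2 v‖) ^ 2 := by
    gcongr
    exact T.le_opNorm _
  rw [dotProduct_self_eq_norm_sq, dotProduct_self_eq_norm_sq]
  refine hT.trans ?_
  rw [mul_pow]
  gcongr
  exact (lt_add_one _).le

theorem exists_dotProduct_mulVec_le (M : Matrix n n ℝ) :
    ∃ K > 0, ∀ v : n → ℝ, v ⬝ᵥ (M *ᵥ v) ≤ K * (v ⬝ᵥ v) := by
  obtain ⟨K, hK, h⟩ := exists_mulVec_dotProduct_mulVec_le M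
  refine ⟨1 + K, by positivity, fun v => ?_⟩
  have hsq := dotProduct_self_nonneg (v - M *ᵥ v)
  simp only [sub_dotProduct, dotProduct_sub, dotProduct_comm (M *ᵥ v) v] at hsq
  linarith [h v, dotProduct_self_nonneg v, dotProduct_self_nonneg (M *ᵥ v)]

open scoped MatrixOrder in
theorem exists_le_dotProduct_mulVec {M : Matrix n n ℝ} (hM : M.PosDef) :
    ∃ μ > 0, ∀ v : n → ℝ, μ * (v ⬝ᵥ v) ≤ v ⬝ᵥ (M *ᵥ v) := by
  classical
  obtain ⟨R, hR, rfl⟩ :=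
    CStarAlgebra.isStrictlyPositive_iff_eq_star_mul_self.1 hM.isStrictlyPositive
  obtain ⟨K, hK, h⟩ := exists_mulVec_dotProduct_mulVec_le R⁻¹
  refine ⟨K⁻¹, inv_pos.2 hK, fun v => ?_⟩
  have hv : R⁻¹ *ᵥ (R *ᵥ v) = v := by
    rw [mulVec_mulVec, nonsing_inv_mul _ ((isUnit_iff_isUnit_det R).1 hR), one_mulVec]
  have hsq : v ⬝ᵥ ((star R * R) *ᵥ v) = (R *ᵥ v) ⬝ᵥ (R *ᵥ v) := by
    rw [← mulVec_mulVec, star_eq_conjTranspose, conjTranspose_eq_transpose_of_trivial,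
      dotProduct_transpose_mulVec]
  rw [hsq, inv_mul_le_iff₀ hK]
  simpa only [hv] using h (R *ᵥ v)

theorem hasDerivAt_dotProduct_mulVec {M : Matrix n n ℝ} (hM : M.IsSymm) {u : ℝ → n → ℝ}
    {u' : n → ℝ} {t : ℝ} (hu : HasDerivAt u u' t) :
    HasDerivAt (fun s => u s ⬝ᵥ (M *ᵥ u s)) (2 * (u' ⬝ᵥ (M *ᵥ u t))) t := by
  have hMu : HasDerivAt (fun s => M *ᵥ u s) (M *ᵥ u') t :=
    (LinearMap.toContinuousLinearMap (Matrix.mulVecLin M)).hasFDerivAt.comp_hasDerivAt t hu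
  rw [hasDerivAt_pi] at hu hMu
  have hsum := HasDerivAt.fun_sum (u := Finset.univ) fun i _ => (hu i).mul (hMu i)
  have hsymm : u t ⬝ᵥ (M *ᵥ u') = u' ⬝ᵥ (M *ᵥ u t) := by
    rw [← dotProduct_transpose_mulVec, hM.eq]
  refine hsum.congr_deriv ?_
  rw [Finset.sum_add_distrib, two_mul]
  exact congrArg (u' ⬝ᵥ (M *ᵥ u t) + ·) hsymm

theorem mulVec_dotProduct_inv_transpose_mulVec [DecidableEq n] {X : Matrix n n ℝ} (hX : IsUnit X)
    (J : Matrix n m ℝ) (u : n → ℝ) (v : m → ℝ) :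
    (X *ᵥ u) ⬝ᵥ ((Xᵀ⁻¹ * J) *ᵥ v) = u ⬝ᵥ (J *ᵥ v) := by
  have hdet : IsUnit Xᵀ.det := by rwa [det_transpose, ← isUnit_iff_isUnit_det]
  rw [dotProduct_comm, ← dotProduct_transpose_mulVec, mulVec_mulVec,
    mul_nonsing_inv_cancel_left _ _ hdet]

theorem isUnit_of_forall_mulVec_eq_zero [DecidableEq n] {M : Matrix n n ℝ}
    (h : ∀ v, M *ᵥ v = 0 → v = 0) : IsUnit M :=
  mulVec_injective_iff_isUnit.1 ((injective_iff_map_eq_zero M.mulVecLin).2 h)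

theorem dotProduct_mulVec_neg {M : Matrix n n ℝ} (hM : (-M).PosDef) {v : n → ℝ} (hv : v ≠ 0) :
    v ⬝ᵥ (M *ᵥ v) < 0 := by
  simpa only [star_trivial, Matrix.neg_mulVec, dotProduct_neg, Left.neg_pos_iff] using
    hM.dotProduct_mulVec_pos hv

theorem dotProduct_mulVec_nonpos {M : Matrix n n ℝ} (hM : (-M).PosDef) (v : n → ℝ) :
    v ⬝ᵥ (M *ᵥ v) ≤ 0 := by
  rcases eq_or_ne v 0 with rfl | hv
  · rw [zero_dotProduct]
  · exact (dotProduct_mulVec_neg hM hv).le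

end QuadraticForms

theorem add_mul_nonpos_of_mem_Icc {a b c x y : ℝ} (hc : c ∈ Icc a b) (ha : x + a * y ≤ 0)
    (hb : x + b * y ≤ 0) : x + c * y ≤ 0 := by
  rcases le_total 0 y with hy | hy
  · linarith [mul_le_mul_of_nonneg_right hc.2 hy]
  · linarith [mul_le_mul_of_nonpos_right hc.1 hy]

/-! ## The design inequalities -/

namespace Plant

section DesignLMI

variable {nz ny nw nq ns np : ℕ} {P : Plant nz ny nw nq ns np} {ℓ T₂ lam γ δ χ e : ℝ}
  {P₁ X : Matrix (Fin nz) (Fin nz) ℝ} {P₂ U W : Matrix (Fin ny) (Fin ny) ℝ}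
  {J : Matrix (Fin nz) (Fin ny) ℝ}

theorem dotProduct_designMatrix_mulVec (a ε : Fin nz → ℝ) (b θ : Fin ny → ℝ) (w : Fin nw → ℝ)
    (ζ : Fin ns → ℝ) :
    Sum.elim (Sum.elim (Sum.elim a b) (Sum.elim ε θ)) (Sum.elim w ζ) ⬝ᵥ
      (P.designMatrix ℓ lam γ δ χ e P₁ X P₂ U W J *ᵥ
        Sum.elim (Sum.elim (Sum.elim a b) (Sum.elim ε θ)) (Sum.elim w ζ)) =
      2 * ((X *ᵥ (a + ε)) ⬝ᵥ (P.A *ᵥ ε + P.N *ᵥ w + P.B *ᵥ ζ - a)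
        + (a + ε) ⬝ᵥ (J *ᵥ (θ - P.C *ᵥ ε))
        + (U *ᵥ b) ⬝ᵥ (P.C *ᵥ a - b) + b ⬝ᵥ (W *ᵥ (θ - P.C *ᵥ ε))
        + a ⬝ᵥ (P₁ *ᵥ ε) + e * (b ⬝ᵥ (P₂ *ᵥ θ)))
      + 2 * lam * (ε ⬝ᵥ (P₁ *ᵥ ε)) + (P.Cp *ᵥ ε) ⬝ᵥ (P.Cp *ᵥ ε)
      + χ * ℓ ^ 2 * ((P.S *ᵥ ε) ⬝ᵥ (P.S *ᵥ ε)) + (-δ + 2 * lam) * e * (θ ⬝ᵥ (P₂ *ᵥ θ))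
      - γ ^ 2 * (w ⬝ᵥ w) - χ * (ζ ⬝ᵥ ζ) := by
  have hJ : ∀ u v, (Jᵀ *ᵥ u) ⬝ᵥ v = u ⬝ᵥ (J *ᵥ v) := fun u v => by
    rw [dotProduct_comm, dotProduct_transpose_mulVec]
  have hW : ∀ u v, (Wᵀ *ᵥ u) ⬝ᵥ v = u ⬝ᵥ (W *ᵥ v) := fun u v => by
    rw [dotProduct_comm, dotProduct_transpose_mulVec]
  simp only [designMatrix, he, fromBlocks_mulVec, fromRows_mulVec, fromBlocks_transpose,
    transpose_fromRows, fromBlocks_add, Sum.elim_comp_inl, Sum.elim_comp_inr,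
    fromCols_mulVec, sumElim_dotProduct_sumElim, dotProduct_add, add_dotProduct, dotProduct_sub,
    mulVec_add, mulVec_sub, Matrix.add_mulVec, Matrix.sub_mulVec, Matrix.neg_mulVec,
    dotProduct_neg, transpose_mul, transpose_add, transpose_sub, transpose_neg,
    transpose_transpose, transpose_zero, transpose_smul, Matrix.smul_mulVec, dotProduct_smul,
    smul_eq_mul, zero_mulVec, dotProduct_zero, one_mulVec, ← mulVec_mulVec,
    dotProduct_transpose_mulVec, hJ, hW]
  rw [dotProduct_comm (P.C *ᵥ a), dotProduct_comm (P.A *ᵥ ε) (X *ᵥ a),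
    dotProduct_comm (P.A *ᵥ ε) (X *ᵥ ε), dotProduct_comm (P.N *ᵥ w) (X *ᵥ a),
    dotProduct_comm (P.N *ᵥ w) (X *ᵥ ε), dotProduct_comm (P.B *ᵥ ζ) (X *ᵥ a),
    dotProduct_comm (P.B *ᵥ ζ) (X *ᵥ ε), dotProduct_comm (X *ᵥ a) a, dotProduct_comm (X *ᵥ ε) a,
    dotProduct_comm (U *ᵥ b) b]
  ring

theorem isUnit_of_posDef_neg_designMatrix
    (h : (-(P.designMatrix ℓ lam γ δ χ e P₁ X P₂ U W J)).PosDef) : IsUnit X ∧ IsUnit U := by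
  constructor <;> refine isUnit_of_forall_mulVec_eq_zero fun v hv => ?_ <;> by_contra hne
  · have hne' : Sum.elim (Sum.elim (Sum.elim v (0 : Fin ny → ℝ))
        (Sum.elim (0 : Fin nz → ℝ) (0 : Fin ny → ℝ)))
        (Sum.elim (0 : Fin nw → ℝ) (0 : Fin ns → ℝ)) ≠ 0 := fun h0 =>
      hne (funext fun i => congrFun h0 (Sum.inl (Sum.inl (Sum.inl i))))
    have hneg := dotProduct_mulVec_neg h hne'
    rw [dotProduct_designMatrix_mulVec] at hneg
    simp [hv] at hneg
  · have hne' : Sum.elim (Sum.elim (Sum.elim (0 : Fin nz → ℝ) v)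
        (Sum.elim (0 : Fin nz → ℝ) (0 : Fin ny → ℝ)))
        (Sum.elim (0 : Fin nw → ℝ) (0 : Fin ns → ℝ)) ≠ 0 := fun h0 =>
      hne (funext fun i => congrFun h0 (Sum.inl (Sum.inl (Sum.inr i))))
    have hneg := dotProduct_mulVec_neg h hne'
    rw [dotProduct_designMatrix_mulVec] at hneg
    simp [hv] at hneg

variable {a ε : Fin nz → ℝ} {b θ : Fin ny → ℝ} {w : Fin nw → ℝ} {ζ : Fin ns → ℝ}

-- Along the error dynamics the terms with the multipliers `X` and `U` cancel those with `J`, `W`.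
theorem dissipation_nonpos_of_posDef_neg_designMatrix
    (h : (-(P.designMatrix ℓ lam γ δ χ e P₁ X P₂ U W J)).PosDef)
    (ha : a = P.A *ᵥ ε + (Xᵀ⁻¹ * J) *ᵥ (θ - P.C *ᵥ ε) + P.B *ᵥ ζ + P.N *ᵥ w)
    (hb : b = P.C *ᵥ a + (Uᵀ⁻¹ * W) *ᵥ (θ - P.C *ᵥ ε)) :
    2 * (a ⬝ᵥ (P₁ *ᵥ ε)) + 2 * lam * (ε ⬝ᵥ (P₁ *ᵥ ε)) + (P.Cp *ᵥ ε) ⬝ᵥ (P.Cp *ᵥ ε)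
      + χ * ℓ ^ 2 * ((P.S *ᵥ ε) ⬝ᵥ (P.S *ᵥ ε)) - γ ^ 2 * (w ⬝ᵥ w) - χ * (ζ ⬝ᵥ ζ)
      + e * (2 * (b ⬝ᵥ (P₂ *ᵥ θ)) + (-δ + 2 * lam) * (θ ⬝ᵥ (P₂ *ᵥ θ))) ≤ 0 := by
  obtain ⟨hX, hU⟩ := isUnit_of_posDef_neg_designMatrix h
  have hquad := dotProduct_mulVec_nonpos h
    (Sum.elim (Sum.elim (Sum.elim a b) (Sum.elim ε θ)) (Sum.elim w ζ))
  have hL : P.A *ᵥ ε + P.N *ᵥ w + P.B *ᵥ ζ - a = -((Xᵀ⁻¹ * J) *ᵥ (θ - P.C *ᵥ ε)) := by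
    rw [ha]; abel
  have hH : P.C *ᵥ a - b = -((Uᵀ⁻¹ * W) *ᵥ (θ - P.C *ᵥ ε)) := by
    rw [hb]; abel
  rw [dotProduct_designMatrix_mulVec, hL, hH, dotProduct_neg, dotProduct_neg,
    mulVec_dotProduct_inv_transpose_mulVec hX, mulVec_dotProduct_inv_transpose_mulVec hU] at hquad
  linarith

theorem DesignLMI.dissipation_le (h : P.DesignLMI ℓ T₂ lam γ δ χ P₁ X P₂ U W J)
    (he : e ∈ Icc 1 (Real.exp (δ * T₂)))
    (ha : a = P.A *ᵥ ε + (Xᵀ⁻¹ * J) *ᵥ (θ - P.C *ᵥ ε) + P.B *ᵥ ζ + P.N *ᵥ w)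
    (hb : b = P.C *ᵥ a + (Uᵀ⁻¹ * W) *ᵥ (θ - P.C *ᵥ ε)) :
    2 * (a ⬝ᵥ (P₁ *ᵥ ε) + e * (b ⬝ᵥ (P₂ *ᵥ θ))) - δ * e * (θ ⬝ᵥ (P₂ *ᵥ θ)) ≤
      -(2 * lam) * (ε ⬝ᵥ (P₁ *ᵥ ε) + e * (θ ⬝ᵥ (P₂ *ᵥ θ)))
      - (P.Cp *ᵥ ε) ⬝ᵥ (P.Cp *ᵥ ε) + γ ^ 2 * (w ⬝ᵥ w)
      + χ * (ζ ⬝ᵥ ζ - ℓ ^ 2 * ((P.S *ᵥ ε) ⬝ᵥ (P.S *ᵥ ε))) := by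
  linarith [add_mul_nonpos_of_mem_Icc he
    (dissipation_nonpos_of_posDef_neg_designMatrix h.1 ha hb)
    (dissipation_nonpos_of_posDef_neg_designMatrix h.2 ha hb)]

end DesignLMI

end Plant

/-! ## The Lyapunov function -/

namespace HState

variable {nz ny : ℕ}

/-- The component `θ̃ = C (z - ẑ) - θ`, the error of the held output sample. -/
def θ (x : HState nz ny) : Fin ny → ℝ := fun i => x.err (Sum.inr i)

theorem err_eq_sumElim (x : HState nz ny) : x.err = Sum.elim x.ε x.θ := by
  ext (i | i) <;> rfl

theorem norm_sq_eq (x : HState nz ny) :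
    ‖x‖ ^ 2 = x.z ⬝ᵥ x.z + (x.ε ⬝ᵥ x.ε + x.θ ⬝ᵥ x.θ) + x.τ ^ 2 := by
  rw [EuclideanSpace.real_norm_sq_eq]
  simp only [Fintype.sum_sum_type, Finset.univ_unique, Finset.sum_singleton, dotProduct, z, ε, θ,
    err, τ, sq, add_assoc, PUnit.default_eq_unit]

theorem sq_infDist_attractor {T₂ : ℝ} {x : HState nz ny} (hx : x.τ ∈ Icc 0 T₂) :
    Metric.infDist x (Plant.attractor nz ny T₂) ^ 2 = x.ε ⬝ᵥ x.ε + x.θ ⬝ᵥ x.θ := by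
  set p : HState nz ny := mk x.z 0 x.τ
  have hp : p ∈ Plant.attractor nz ny T₂ := ⟨rfl, hx⟩
  have hsq : ∀ y ∈ Plant.attractor nz ny T₂, dist x y ^ 2 =
      (x - y).z ⬝ᵥ (x - y).z + (x.ε ⬝ᵥ x.ε + x.θ ⬝ᵥ x.θ) + (x - y).τ ^ 2 := fun y hy => by
    have hε : (x - y).ε = x.ε := funext fun i =>
      (congrArg (x.ε i - ·) (congrFun hy.1 (Sum.inl i))).trans (sub_zero _)
    have hθ : (x - y).θ = x.θ := funext fun i =>
      (congrArg (x.θ i - ·) (congrFun hy.1 (Sum.inr i))).trans (sub_zero _)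
    rw [dist_eq_norm, norm_sq_eq, hε, hθ]
  have hdist : dist x p ^ 2 = x.ε ⬝ᵥ x.ε + x.θ ⬝ᵥ x.θ := by
    have hz : (x - p).z = 0 := funext fun i => sub_self (x.z i)
    have hτ : (x - p).τ = 0 := sub_self x.τ
    rw [hsq p hp, hz, hτ, zero_dotProduct, zero_add, sq, mul_zero, add_zero]
  have hmin : ∀ y ∈ Plant.attractor nz ny T₂, dist x p ≤ dist x y := fun y hy => by
    rw [← sq_le_sq₀ dist_nonneg dist_nonneg, hdist, hsq y hy]
    linarith [dotProduct_self_nonneg (x - y).z, sq_nonneg (x - y).τ]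
  rw [← hdist, le_antisymm (Metric.infDist_le_dist_of_mem hp) ((Metric.le_infDist ⟨p, hp⟩).2
    fun y hy => hmin y hy)]

/-- The Lyapunov function of the error system. Since `τ` decreases during flows, so does the weight
on `θ̃`, which offsets the growth of `θ̃` between samples. -/
noncomputable def lyap (P₁ : Matrix (Fin nz) (Fin nz) ℝ) (P₂ : Matrix (Fin ny) (Fin ny) ℝ)
    (δ : ℝ) (x : HState nz ny) : ℝ :=
  x.ε ⬝ᵥ (P₁ *ᵥ x.ε) + Real.exp (δ * x.τ) * (x.θ ⬝ᵥ (P₂ *ᵥ x.θ))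

variable {P₁ : Matrix (Fin nz) (Fin nz) ℝ} {P₂ : Matrix (Fin ny) (Fin ny) ℝ} {δ : ℝ}

theorem contDiff_lyap : ContDiff ℝ 1 (lyap P₁ P₂ δ : HState nz ny → ℝ) := by
  unfold lyap θ ε err τ mulVec dotProduct
  fun_prop

theorem hasDerivAt_apply {f : ℝ → HState nz ny} {f' : HState nz ny} {t : ℝ}
    (h : HasDerivAt f f' t) (i : Fin nz ⊕ ((Fin nz ⊕ Fin ny) ⊕ Unit)) :
    HasDerivAt (fun s => f s i) (f' i) t :=
  (EuclideanSpace.proj (𝕜 := ℝ) i).hasFDerivAt.comp_hasDerivAt t h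

theorem fderiv_lyap (hP₁ : P₁.IsSymm) (hP₂ : P₂.IsSymm) (x v : HState nz ny) :
    fderiv ℝ (lyap P₁ P₂ δ) x v = 2 * (v.ε ⬝ᵥ (P₁ *ᵥ x.ε)) +
      Real.exp (δ * x.τ) * (2 * (v.θ ⬝ᵥ (P₂ *ᵥ x.θ)) + δ * v.τ * (x.θ ⬝ᵥ (P₂ *ᵥ x.θ))) := by
  let line : ℝ → HState nz ny := fun s => x + s • v
  have hline : HasDerivAt line v 0 :=
    (((hasDerivAt_id (0 : ℝ)).smul_const v).const_add x).congr_deriv (one_smul ℝ v)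
  have hx : line 0 = x := by simp only [line, zero_smul, add_zero]
  have hε : HasDerivAt (fun s => (line s).ε) v.ε 0 :=
    hasDerivAt_pi.2 fun i => hasDerivAt_apply hline _
  have hθ : HasDerivAt (fun s => (line s).θ) v.θ 0 :=
    hasDerivAt_pi.2 fun i => hasDerivAt_apply hline _
  have hτ : HasDerivAt (fun s => (line s).τ) v.τ 0 := hasDerivAt_apply hline _
  have hlyap := (hasDerivAt_dotProduct_mulVec hP₁ hε).add
    ((hτ.const_mul δ).exp.mul (hasDerivAt_dotProduct_mulVec hP₂ hθ))
  have hfderiv := (contDiff_lyap (P₁ := P₁) (P₂ := P₂) (δ := δ)).differentiable one_ne_zero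
    |>.differentiableAt (x := line 0) |>.hasFDerivAt.comp_hasDerivAt 0 hline
  rw [hx] at hlyap hfderiv
  rw [hfderiv.unique hlyap]
  ring

theorem exists_le_lyap (hP₁ : P₁.PosDef) (hP₂ : P₂.PosDef) (hδ : 0 ≤ δ) :
    ∃ m > 0, ∀ x : HState nz ny, 0 ≤ x.τ → m * (x.ε ⬝ᵥ x.ε + x.θ ⬝ᵥ x.θ) ≤ x.lyap P₁ P₂ δ := by
  obtain ⟨m₁, hm₁, h₁⟩ := exists_le_dotProduct_mulVec hP₁
  obtain ⟨m₂, hm₂, h₂⟩ := exists_le_dotProduct_mulVec hP₂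
  refine ⟨min m₁ m₂, lt_min hm₁ hm₂, fun x hx => ?_⟩
  have hε := dotProduct_self_nonneg x.ε
  have hθ := dotProduct_self_nonneg x.θ
  have hexp : 1 ≤ Real.exp (δ * x.τ) := Real.one_le_exp (mul_nonneg hδ hx)
  calc min m₁ m₂ * (x.ε ⬝ᵥ x.ε + x.θ ⬝ᵥ x.θ)
      ≤ m₁ * (x.ε ⬝ᵥ x.ε) + 1 * (m₂ * (x.θ ⬝ᵥ x.θ)) := by
        rw [mul_add, one_mul]
        gcongr
        exacts [min_le_left _ _, min_le_right _ _]
    _ ≤ x.lyap P₁ P₂ δ := by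
        refine add_le_add (h₁ _) (mul_le_mul hexp (h₂ _) ?_ ?_) <;> positivity

theorem exists_lyap_le (P₁ : Matrix (Fin nz) (Fin nz) ℝ) (P₂ : Matrix (Fin ny) (Fin ny) ℝ)
    (hδ : 0 ≤ δ) (T₂ : ℝ) : ∃ M > 0, ∀ x : HState nz ny, x.τ ≤ T₂ →
      x.lyap P₁ P₂ δ ≤ M * (x.ε ⬝ᵥ x.ε + x.θ ⬝ᵥ x.θ) := by
  obtain ⟨M₁, hM₁, h₁⟩ := exists_dotProduct_mulVec_le P₁
  obtain ⟨M₂, hM₂, h₂⟩ := exists_dotProduct_mulVec_le P₂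
  refine ⟨M₁ + Real.exp (δ * T₂) * M₂, by positivity, fun x hx => ?_⟩
  have hε := dotProduct_self_nonneg x.ε
  have hθ := dotProduct_self_nonneg x.θ
  calc x.lyap P₁ P₂ δ
      ≤ M₁ * (x.ε ⬝ᵥ x.ε) + Real.exp (δ * x.τ) * (M₂ * (x.θ ⬝ᵥ x.θ)) := by
        unfold lyap
        gcongr
        exacts [h₁ _, h₂ _]
    _ ≤ M₁ * (x.ε ⬝ᵥ x.ε) + Real.exp (δ * T₂) * (M₂ * (x.θ ⬝ᵥ x.θ)) := by gcongr
    _ ≤ (M₁ + Real.exp (δ * T₂) * M₂) * (x.ε ⬝ᵥ x.ε + x.θ ⬝ᵥ x.θ) := by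
        linarith [mul_nonneg hM₁.le hθ, mul_nonneg (mul_pos (Real.exp_pos (δ * T₂)) hM₂).le hε]

end HState

/-! ## The error system -/

namespace Plant

variable {nz ny nw nq ns np : ℕ} {P : Plant nz ny nw nq ns np} {L : Matrix (Fin nz) (Fin ny) ℝ}
  {H : Matrix (Fin ny) (Fin ny) ℝ} {ℓ T₁ T₂ lam γ δ χ : ℝ}

section Flow

theorem errorSystem_flow_τ (x : HState nz ny) (w : Vec nw) :
    ((P.errorSystem L H T₁ T₂).flow x w).τ = -1 := rfl

theorem errorSystem_flow_ε (x : HState nz ny) (w : Vec nw) :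
    ((P.errorSystem L H T₁ T₂).flow x w).ε = P.A *ᵥ x.ε + L *ᵥ (x.θ - P.C *ᵥ x.ε) +
      P.B *ᵥ P.zeta x.z x.ε + P.N *ᵥ w.ofLp := by
  have hε : ((P.errorSystem L H T₁ T₂).flow x w).ε = fun i =>
    (P.calF L H *ᵥ x.err + P.calQ *ᵥ P.zeta x.z x.ε + P.calT *ᵥ w.ofLp) (Sum.inl i) := rfl
  rw [hε, HState.err_eq_sumElim, calF, calQ, calT, fromBlocks_mulVec, fromRows_mulVec,
    fromRows_mulVec]
  ext i
  simp only [Pi.add_apply, Pi.sub_apply, Sum.elim_inl, Sum.elim_comp_inl, Sum.elim_comp_inr,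
    Matrix.sub_mulVec, mulVec_sub, ← mulVec_mulVec]
  ring

theorem errorSystem_flow_θ (x : HState nz ny) (w : Vec nw) :
    ((P.errorSystem L H T₁ T₂).flow x w).θ = P.C *ᵥ ((P.errorSystem L H T₁ T₂).flow x w).ε +
      H *ᵥ (x.θ - P.C *ᵥ x.ε) := by
  have hθ : ((P.errorSystem L H T₁ T₂).flow x w).θ = fun i =>
    (P.calF L H *ᵥ x.err + P.calQ *ᵥ P.zeta x.z x.ε + P.calT *ᵥ w.ofLp) (Sum.inr i) := rfl
  rw [hθ, errorSystem_flow_ε, HState.err_eq_sumElim, calF, calQ, calT, fromBlocks_mulVec,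
    fromRows_mulVec, fromRows_mulVec]
  ext i
  simp only [Pi.add_apply, Pi.sub_apply, Sum.elim_inr, Sum.elim_comp_inl, Sum.elim_comp_inr,
    Matrix.sub_mulVec, Matrix.add_mulVec, mulVec_sub, mulVec_add, ← mulVec_mulVec]
  ring

theorem zeta_dotProduct_le (hψ : ∀ v₁ v₂, ‖P.ψ v₁ - P.ψ v₂‖ ≤ ℓ * ‖v₁ - v₂‖)
    (v₁ v₂ : Fin nz → ℝ) :
    P.zeta v₁ v₂ ⬝ᵥ P.zeta v₁ v₂ ≤ ℓ ^ 2 * ((P.S *ᵥ v₂) ⬝ᵥ (P.S *ᵥ v₂)) := by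
  have hnorm : ‖(WithLp.toLp 2 (P.zeta v₁ v₂) : Vec ns)‖ ≤
      ℓ * ‖(WithLp.toLp 2 (P.S *ᵥ v₂) : Vec nq)‖ := by
    refine (hψ (WithLp.toLp 2 (P.S *ᵥ v₁)) (WithLp.toLp 2 (P.S *ᵥ (v₁ - v₂)))).trans_eq ?_
    rw [← WithLp.toLp_sub, ← mulVec_sub, sub_sub_cancel]
  rw [dotProduct_self_eq_norm_sq, dotProduct_self_eq_norm_sq, ← mul_pow]
  exact pow_le_pow_left₀ (norm_nonneg _) hnorm 2

theorem DesignLMI.fderiv_lyap_flow_le {P₁ X : Matrix (Fin nz) (Fin nz) ℝ}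
    {P₂ U W : Matrix (Fin ny) (Fin ny) ℝ} {J : Matrix (Fin nz) (Fin ny) ℝ}
    (hLMI : P.DesignLMI ℓ T₂ lam γ δ χ P₁ X P₂ U W J)
    (hψ : ∀ v₁ v₂, ‖P.ψ v₁ - P.ψ v₂‖ ≤ ℓ * ‖v₁ - v₂‖) (hP₁ : P₁.IsSymm) (hP₂ : P₂.IsSymm)
    (hδ : 0 ≤ δ) (hχ : 0 ≤ χ) {x : HState nz ny} (hx : x.τ ∈ Icc 0 T₂) (w : Vec nw) :
    fderiv ℝ (HState.lyap P₁ P₂ δ) x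
        ((P.errorSystem (Xᵀ⁻¹ * J) (Uᵀ⁻¹ * W) T₁ T₂).flow x w) ≤
      -(2 * lam) * x.lyap P₁ P₂ δ - ‖P.perfOutput x‖ ^ 2 + γ ^ 2 * ‖w‖ ^ 2 := by
  have hexp : Real.exp (δ * x.τ) ∈ Icc 1 (Real.exp (δ * T₂)) :=
    ⟨Real.one_le_exp (mul_nonneg hδ hx.1),
      Real.exp_le_exp.2 (mul_le_mul_of_nonneg_left hx.2 hδ)⟩
  have hdiss := hLMI.dissipation_le hexp
    (errorSystem_flow_ε (L := Xᵀ⁻¹ * J) (H := Uᵀ⁻¹ * W) (T₁ := T₁) (T₂ := T₂) x w)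
    (errorSystem_flow_θ (L := Xᵀ⁻¹ * J) (H := Uᵀ⁻¹ * W) (T₁ := T₁) (T₂ := T₂) x w)
  have hζ := mul_nonneg hχ (sub_nonneg.2 (zeta_dotProduct_le hψ x.z x.ε))
  rw [dotProduct_self_eq_norm_sq (P.Cp *ᵥ _), dotProduct_self_eq_norm_sq w.ofLp] at hdiss
  rw [HState.fderiv_lyap hP₁ hP₂, errorSystem_flow_τ]
  simp only [HState.lyap, perfOutput]
  linarith

end Flow

section Jump

variable {x g : HState nz ny} {η : Vec ny}

theorem τ_mem_of_mem_jump (hg : g ∈ (P.errorSystem L H T₁ T₂).jump x η) : g.τ ∈ Icc T₁ T₂ := by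
  obtain ⟨v, hv, rfl⟩ := hg
  exact hv

theorem ε_eq_of_mem_jump (hg : g ∈ (P.errorSystem L H T₁ T₂).jump x η) : g.ε = x.ε := by
  obtain ⟨v, -, rfl⟩ := hg
  change (fun i => (calG nz ny *ᵥ x.err + calN nz ny *ᵥ η.ofLp) (Sum.inl i)) = x.ε
  rw [HState.err_eq_sumElim, calG, calN, fromBlocks_mulVec, fromRows_mulVec]
  ext i
  simp

theorem θ_eq_of_mem_jump (hg : g ∈ (P.errorSystem L H T₁ T₂).jump x η) : g.θ = -η.ofLp := by
  obtain ⟨v, -, rfl⟩ := hg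
  change (fun i => (calG nz ny *ᵥ x.err + calN nz ny *ᵥ η.ofLp) (Sum.inr i)) = -η.ofLp
  rw [HState.err_eq_sumElim, calG, calN, fromBlocks_mulVec, fromRows_mulVec]
  ext i
  simp [Matrix.neg_mulVec]

theorem exists_lyap_jump_le (P₁ : Matrix (Fin nz) (Fin nz) ℝ) {P₂ : Matrix (Fin ny) (Fin ny) ℝ}
    (hδ : 0 ≤ δ) (hP₂ : P₂.PosDef) :
    ∃ p, 0 ≤ p ∧ ∀ (x : HState nz ny) (η : Vec ny), ∀ g ∈ (P.errorSystem L H T₁ T₂).jump x η,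
      g.lyap P₁ P₂ δ ≤ x.lyap P₁ P₂ δ + p * ‖η‖ ^ 2 := by
  obtain ⟨K, hK, hle⟩ := exists_dotProduct_mulVec_le P₂
  refine ⟨Real.exp (δ * T₂) * K, by positivity, fun x η g hg => ?_⟩
  have hθ : 0 ≤ x.θ ⬝ᵥ (P₂ *ᵥ x.θ) := by
    simpa only [star_trivial] using hP₂.posSemidef.dotProduct_mulVec_nonneg x.θ
  calc g.lyap P₁ P₂ δ
      = x.ε ⬝ᵥ (P₁ *ᵥ x.ε) + Real.exp (δ * g.τ) * (η.ofLp ⬝ᵥ (P₂ *ᵥ η.ofLp)) := by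
        rw [HState.lyap, ε_eq_of_mem_jump hg, θ_eq_of_mem_jump hg, mulVec_neg, neg_dotProduct,
          dotProduct_neg, neg_neg]
    _ ≤ x.ε ⬝ᵥ (P₁ *ᵥ x.ε) + Real.exp (δ * g.τ) * (K * ‖η‖ ^ 2) := by
        gcongr
        exact (hle _).trans_eq (by rw [dotProduct_self_eq_norm_sq])
    _ ≤ x.ε ⬝ᵥ (P₁ *ᵥ x.ε) + Real.exp (δ * T₂) * (K * ‖η‖ ^ 2) := by
        gcongr
        exact (τ_mem_of_mem_jump hg).2
    _ ≤ x.lyap P₁ P₂ δ + Real.exp (δ * T₂) * K * ‖η‖ ^ 2 := by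
        rw [HState.lyap, mul_assoc]
        linarith [mul_nonneg (Real.exp_pos (δ * x.τ)).le hθ]

end Jump

theorem DesignLMI.isStorageFunction {P₁ X : Matrix (Fin nz) (Fin nz) ℝ}
    {P₂ U W : Matrix (Fin ny) (Fin ny) ℝ} {J : Matrix (Fin nz) (Fin ny) ℝ}
    (hLMI : P.DesignLMI ℓ T₂ lam γ δ χ P₁ X P₂ U W J)
    (hψ : ∀ v₁ v₂, ‖P.ψ v₁ - P.ψ v₂‖ ≤ ℓ * ‖v₁ - v₂‖) (hP₁ : P₁.PosDef) (hP₂ : P₂.PosDef)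
    (hδ : 0 ≤ δ) (hχ : 0 ≤ χ) (T₁ : ℝ) :
    IsStorageFunction (P.errorSystem (Xᵀ⁻¹ * J) (Uᵀ⁻¹ * W) T₁ T₂) (attractor nz ny T₂)
      P.perfOutput lam γ (HState.lyap P₁ P₂ δ) where
  contDiff := HState.contDiff_lyap
  lower := by
    obtain ⟨m, hm, hle⟩ := HState.exists_le_lyap hP₁ hP₂ hδ
    exact ⟨m, hm, fun x hx => HState.sq_infDist_attractor hx ▸ hle x hx.1⟩
  upper := by
    obtain ⟨M, hM, hle⟩ := HState.exists_lyap_le P₁ P₂ hδ T₂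
    exact ⟨M, hM, fun x hx => HState.sq_infDist_attractor hx ▸ hle x hx.2⟩
  flow x hx w := hLMI.fderiv_lyap_flow_le hψ hP₁.isHermitian hP₂.isHermitian hδ hχ hx w
  jump := by
    obtain ⟨p, hp, hle⟩ := exists_lyap_jump_le (P := P) (L := Xᵀ⁻¹ * J) (H := Uᵀ⁻¹ * W)
      (T₁ := T₁) (T₂ := T₂) P₁ hδ hP₂
    exact ⟨p, hp, fun x _ => hle x⟩

theorem continuous_perfOutput : Continuous (P.perfOutput : HState nz ny → Vec np) := by
  unfold perfOutput HState.ε HState.err mulVec dotProduct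
  fun_prop

end Plant

/-! ## Timer, dwell time and viability of the error system -/

namespace HState

variable {nz ny : ℕ}

theorem continuous_τ : Continuous (τ : HState nz ny → ℝ) := by
  unfold τ
  fun_prop

theorem τ_eq_sub_of_ae_hasDerivAt {f : ℝ → HState nz ny} {r s : ℝ} (hrs : r ≤ s)
    (hf : AbsolutelyContinuousOnInterval f r s)
    (h : ∀ᵐ x ∂(volume.restrict (Icc r s)), HasDerivAt (fun y => (f y).τ) (-1) x) :
    (f s).τ = (f r).τ - (s - r) := by
  have hτ : AbsolutelyContinuousOnInterval (fun x => (f x).τ) r s :=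
    absolutelyContinuousOnInterval_comp_of_locallyLipschitz (EuclideanSpace.proj (𝕜 := ℝ)
      (Sum.inr (Sum.inr ()) : Fin nz ⊕ ((Fin nz ⊕ Fin ny) ⊕ Unit))).lipschitz.locallyLipschitz hf
  have hupper := sub_le_mul_of_ae_hasDerivAt_le hrs hτ (M := -1) (h.mono fun x hx => ⟨hx, le_rfl⟩)
  have hlower := sub_le_mul_of_ae_hasDerivAt_le hrs hτ.neg (f' := fun _ => 1) (M := 1)
    (h.mono fun x hx => ⟨by simpa only [neg_neg] using hx.neg, le_rfl⟩)
  simp only [Pi.neg_apply] at hlower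
  linarith

end HState

section Lipschitz

variable {A B : Type*} [PseudoMetricSpace A] [NormedAddCommGroup B]

theorem exists_lipschitzWith_add {f g : A → B} (hf : ∃ K, LipschitzWith K f)
    (hg : ∃ K, LipschitzWith K g) : ∃ K, LipschitzWith K fun x => f x + g x :=
  hf.elim fun _ hK => hg.imp' _ fun _ => hK.add

theorem exists_lipschitzWith_sub {f g : A → B} (hf : ∃ K, LipschitzWith K f)
    (hg : ∃ K, LipschitzWith K g) : ∃ K, LipschitzWith K fun x => f x - g x :=
  hf.elim fun _ hK => hg.imp' _ fun _ => hK.sub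

theorem exists_lipschitzWith_linearMap {V : Type*} [NormedAddCommGroup V] [NormedSpace ℝ V]
    [FiniteDimensional ℝ V] [NormedSpace ℝ B] (f : V →ₗ[ℝ] B) : ∃ K, LipschitzWith K f :=
  ⟨_, f.toContinuousLinearMap.lipschitz⟩

theorem exists_lipschitzWith_mulVec {m n : Type*} [Fintype m] [Fintype n] (M : Matrix m n ℝ)
    {g : A → n → ℝ} (hg : ∃ K, LipschitzWith K g) : ∃ K, LipschitzWith K fun x => M *ᵥ g x :=
  hg.imp' _ fun _ h => M.mulVecLin.toContinuousLinearMap.lipschitz.comp h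

end Lipschitz

theorem HybridSystem.hasLinearGrowth_of_lipschitzWith {X W Y : Type*} [NormedAddCommGroup X]
    [NormedAddCommGroup W] {Sys : HybridSystem X W Y} {K : NNReal}
    (hK : LipschitzWith K fun p : X × W => Sys.flow p.1 p.2) : Sys.HasLinearGrowth := by
  refine ⟨‖Sys.flow 0 0‖ + K, by positivity, fun x w => ?_⟩
  calc ‖Sys.flow x w‖
      ≤ (‖Sys.flow 0 0‖ + K) * (1 + ‖(x, w)‖) := norm_le_of_lipschitzWith hK (x, w)
    _ ≤ (‖Sys.flow 0 0‖ + K) * (1 + ‖x‖ + ‖w‖) := by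
        rw [add_assoc]
        gcongr
        exact max_le_add_of_nonneg (norm_nonneg x) (norm_nonneg w)

namespace Plant

variable {nz ny nw nq ns np : ℕ} {P : Plant nz ny nw nq ns np} {L : Matrix (Fin nz) (Fin ny) ℝ}
  {H : Matrix (Fin ny) (Fin ny) ℝ} {ℓ T₁ T₂ : ℝ}

theorem errorSystem_hasInvariantFlowSet (hT₁ : 0 ≤ T₁) (hT₂ : 0 ≤ T₂) :
    (P.errorSystem L H T₁ T₂).HasInvariantFlowSet where
  isClosed := isClosed_Icc.preimage HState.continuous_τ
  jumpSet_subset x (hx : x.τ = 0) := show x.τ ∈ Icc 0 T₂ from ⟨hx.ge, hx.trans_le hT₂⟩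
  jump_subset _ _ _ _ hg := Icc_subset_Icc_left hT₁ (τ_mem_of_mem_jump hg)

theorem errorSystem_hasDwellTime : (P.errorSystem L H T₁ T₂).HasDwellTime T₁ := by
  intro E φ w η t h hE s j hs
  have hend : (t (j + 2), j + 1) ∈ E := hE.end_mem hs
  have hτ := HState.τ_eq_sub_of_ae_hasDerivAt (hE.mono (Nat.le_succ (j + 1)))
    (h.absolutelyContinuousOnInterval hE hend)
    ((h.ae_flow hE hend).mono fun x hx => HState.hasDerivAt_apply hx.2 _)
  have hstart : (φ (t (j + 1)) (j + 1)).τ ∈ Icc T₁ T₂ :=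
    τ_mem_of_mem_jump (h.jumps _ _ (hE.jump_mem hend)).2
  have hzero : (φ (t (j + 2)) (j + 1)).τ = 0 := (h.jumps _ _ (hE.jump_mem hs)).1
  linarith [hstart.1]

theorem exists_lipschitzWith_nonlin (hψ : ∀ v₁ v₂, ‖P.ψ v₁ - P.ψ v₂‖ ≤ ℓ * ‖v₁ - v₂‖)
    {A : Type*} [PseudoMetricSpace A] {g : A → Fin nz → ℝ} (hg : ∃ K, LipschitzWith K g) :
    ∃ K, LipschitzWith K fun x => P.nonlin (g x) := by
  have hψ' : LipschitzWith ℓ.toNNReal P.ψ := LipschitzWith.of_dist_le' fun x y => by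
    simpa only [dist_eq_norm] using hψ x y
  obtain ⟨K₁, h₁⟩ := exists_lipschitzWith_linearMap
    (WithLp.linearEquiv 2 ℝ (Fin nq → ℝ)).symm.toLinearMap
  obtain ⟨K₂, h₂⟩ := exists_lipschitzWith_linearMap
    (WithLp.linearEquiv 2 ℝ (Fin ns → ℝ)).toLinearMap
  obtain ⟨K₃, h₃⟩ := exists_lipschitzWith_mulVec P.S hg
  exact ⟨_, h₂.comp (hψ'.comp (h₁.comp h₃))⟩

theorem exists_lipschitzWith_mk {A : Type*} [PseudoMetricSpace A] {f : A → Fin nz → ℝ}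
    {g : A → Fin nz ⊕ Fin ny → ℝ} (hf : ∃ K, LipschitzWith K f) (hg : ∃ K, LipschitzWith K g)
    (v : ℝ) : ∃ K, LipschitzWith K fun x => (HState.mk (f x) (g x) v : HState nz ny) := by
  let mkₗ : (Fin nz → ℝ) × (Fin nz ⊕ Fin ny → ℝ) →ₗ[ℝ] HState nz ny :=
    { toFun := fun p => HState.mk p.1 p.2 0
      map_add' := fun p q => by
        ext (_ | _ | _)
        exacts [rfl, rfl, (add_zero (0 : ℝ)).symm]
      map_smul' := fun c p => by
        ext (_ | _ | _)
        exacts [rfl, rfl, (mul_zero c).symm] }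
  have hmk : ∀ x, HState.mk (f x) (g x) v = mkₗ (f x, g x) + HState.mk 0 0 v := fun x => by
    ext (i | i | _)
    exacts [(add_zero (f x i)).symm, (add_zero (g x i)).symm, (zero_add v).symm]
  obtain ⟨K₁, h₁⟩ := hf
  obtain ⟨K₂, h₂⟩ := hg
  obtain ⟨K₃, h₃⟩ := exists_lipschitzWith_linearMap mkₗ
  simp only [hmk]
  exact ⟨_, (h₃.comp (h₁.prodMk h₂)).add (LipschitzWith.const _)⟩

theorem exists_lipschitzWith_flow (hψ : ∀ v₁ v₂, ‖P.ψ v₁ - P.ψ v₂‖ ≤ ℓ * ‖v₁ - v₂‖) :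
    ∃ K, LipschitzWith K fun p : HState nz ny × Vec nw =>
      (P.errorSystem L H T₁ T₂).flow p.1 p.2 := by
  let zₗ : HState nz ny × Vec nw →ₗ[ℝ] Fin nz → ℝ :=
    { toFun := fun p => p.1.z, map_add' := fun _ _ => rfl, map_smul' := fun _ _ => rfl }
  let errₗ : HState nz ny × Vec nw →ₗ[ℝ] Fin nz ⊕ Fin ny → ℝ :=
    { toFun := fun p => p.1.err, map_add' := fun _ _ => rfl, map_smul' := fun _ _ => rfl }
  let εₗ : HState nz ny × Vec nw →ₗ[ℝ] Fin nz → ℝ :=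
    { toFun := fun p => p.1.ε, map_add' := fun _ _ => rfl, map_smul' := fun _ _ => rfl }
  let wₗ : HState nz ny × Vec nw →ₗ[ℝ] Fin nw → ℝ :=
    { toFun := fun p => p.2.ofLp, map_add' := fun _ _ => rfl, map_smul' := fun _ _ => rfl }
  have hz := exists_lipschitzWith_linearMap zₗ
  have hw := exists_lipschitzWith_linearMap wₗ
  have hζ := exists_lipschitzWith_sub (exists_lipschitzWith_nonlin hψ hz)
    (exists_lipschitzWith_nonlin hψ
      (exists_lipschitzWith_sub hz (exists_lipschitzWith_linearMap εₗ)))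
  exact exists_lipschitzWith_mk
    (exists_lipschitzWith_add
      (exists_lipschitzWith_add (exists_lipschitzWith_mulVec P.A hz)
        (exists_lipschitzWith_mulVec P.B (exists_lipschitzWith_nonlin hψ hz)))
      (exists_lipschitzWith_mulVec P.N hw))
    (exists_lipschitzWith_add
      (exists_lipschitzWith_add
        (exists_lipschitzWith_mulVec (P.calF L H) (exists_lipschitzWith_linearMap errₗ))
        (exists_lipschitzWith_mulVec P.calQ hζ))
      (exists_lipschitzWith_mulVec P.calT hw))
    (-1)

theorem errorSystem_hasLinearGrowth (hψ : ∀ v₁ v₂, ‖P.ψ v₁ - P.ψ v₂‖ ≤ ℓ * ‖v₁ - v₂‖) :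
    (P.errorSystem L H T₁ T₂).HasLinearGrowth :=
  (exists_lipschitzWith_flow hψ).elim fun _ => HybridSystem.hasLinearGrowth_of_lipschitzWith

theorem τ_mem_of_hasDerivAt_flow {α : ℝ → HState nz ny} {T h s : ℝ} (hα₀ : (α T).τ ∈ Icc h T₂)
    (hac : AbsolutelyContinuousOnInterval α T (T + h))
    (hα : ∀ r ∈ Ioo T (T + h), HasDerivAt α ((P.errorSystem L H T₁ T₂).flow (α r) 0) r)
    (hs : s ∈ Ioo T (T + h)) : (α s).τ ∈ Icc 0 T₂ := by
  have hTs : uIcc T s ⊆ uIcc T (T + h) := by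
    rw [uIcc_of_le hs.1.le, uIcc_of_le (hs.1.trans hs.2).le]
    exact Icc_subset_Icc_right hs.2.le
  have hderiv : ∀ᵐ r ∂(volume.restrict (Icc T s)), HasDerivAt (fun y => (α y).τ) (-1) r := by
    rw [← restrict_Ioo_eq_restrict_Icc]
    filter_upwards [ae_restrict_mem measurableSet_Ioo] with r hr
    exact HState.hasDerivAt_apply (hα r ⟨hr.1, hr.2.trans hs.2⟩) _
  rw [HState.τ_eq_sub_of_ae_hasDerivAt hs.1.le (hac.mono hTs) hderiv]
  constructor <;> linarith [hα₀.1, hα₀.2, hs.1, hs.2]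

theorem errorSystem_isViable (hT₁₂ : T₁ ≤ T₂)
    (hψ : ∀ v₁ v₂, ‖P.ψ v₁ - P.ψ v₂‖ ≤ ℓ * ‖v₁ - v₂‖) :
    (P.errorSystem L H T₁ T₂).IsViable := by
  rintro x ⟨hx₀, hx⟩
  rcases hx₀.eq_or_lt with hzero | hpos
  · exact Or.inl ⟨hzero.symm, fun η => ⟨_, T₁, left_mem_Icc.2 hT₁₂, rfl⟩⟩
  obtain ⟨K, hK⟩ := exists_lipschitzWith_flow (L := L) (H := H) (T₁ := T₁) (T₂ := T₂) hψ
  obtain ⟨h₀, hh₀, hsol⟩ := exists_forall_hasDerivAt_Ioo_of_lipschitzWith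
    (hK.comp (LipschitzWith.prodMk_right (0 : Vec nw))) x
  refine Or.inr ⟨min h₀ x.τ, lt_min hh₀ hpos, fun T => ?_⟩
  obtain ⟨α, rfl, hac, hα⟩ := hsol T _ ⟨(lt_min hh₀ hpos).le, min_le_left _ _⟩
  exact ⟨α, rfl, hac, fun s hs =>
    ⟨τ_mem_of_hasDerivAt_flow ⟨min_le_right _ _, hx⟩ hac hα hs, hα s hs⟩⟩

end Plant

theorem proposition3 {nz ny nw nq ns np : ℕ} (P : Plant nz ny nw nq ns np)
    (ℓ T₁ T₂ lam γ : ℝ) (hℓ : 0 < ℓ) (hT₁ : 0 < T₁) (hT₁₂ : T₁ ≤ T₂) (hlam : 0 < lam) (hγ : 0 < γ)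
    (hψ : ∀ v₁ v₂, ‖P.ψ v₁ - P.ψ v₂‖ ≤ ℓ * ‖v₁ - v₂‖)
    (P₁ X : Matrix (Fin nz) (Fin nz) ℝ) (P₂ U W : Matrix (Fin ny) (Fin ny) ℝ)
    (J : Matrix (Fin nz) (Fin ny) ℝ) (δ χ : ℝ) (hP₁ : P₁.PosDef) (hP₂ : P₂.PosDef)
    (hδ : 0 < δ) (hχ : 0 < χ) (hLMI : P.DesignLMI ℓ T₂ lam γ δ χ P₁ X P₂ U W J) :
    IsUnit X ∧ IsUnit U ∧ P.ObserverSolves T₁ T₂ lam γ (Xᵀ⁻¹ * J) (Uᵀ⁻¹ * W) := by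
  obtain ⟨hX, hU⟩ := Plant.isUnit_of_posDef_neg_designMatrix hLMI.1
  have hV := hLMI.isStorageFunction hψ hP₁ hP₂ hδ.le hχ.le T₁
  have hflow := P.errorSystem_hasInvariantFlowSet (L := Xᵀ⁻¹ * J) (H := Uᵀ⁻¹ * W) hT₁.le
    (hT₁.le.trans hT₁₂)
  have hdwell := P.errorSystem_hasDwellTime (L := Xᵀ⁻¹ * J) (H := Uᵀ⁻¹ * W) (T₁ := T₁) (T₂ := T₂)
  have hviable := P.errorSystem_isViable (L := Xᵀ⁻¹ * J) (H := Uᵀ⁻¹ * W) hT₁₂ hψ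
  have hgrowth := P.errorSystem_hasLinearGrowth (L := Xᵀ⁻¹ * J) (H := Uᵀ⁻¹ * W) (T₁ := T₁)
    (T₂ := T₂) hψ
  exact ⟨hX, hU,
    ⟨hV.exists_infDist_le_of_zeroOn hflow hdwell hlam hT₁,
      fun E φ h => h.isCompleteDomain hflow hviable hgrowth⟩,
    ⟨hV.exists_infDist_le_max hflow hdwell hlam hT₁,
      fun E φ w η h hu => h.isCompleteDomain hflow hviable hgrowth hu⟩,
    hV.hasL2Gain hflow Plant.continuous_perfOutput hlam.le hγ.le⟩
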